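/- Let $\mathfrak C=\{0,1\}^{\mathbf N}$ be the Cantor space, and for a finite word $m$ in the letters $0,1$ let $m\cdot\mathfrak C$ be the set of all sequences with prefix $m$ (a standard dyadic interval). A standard dyadic partition is a finite partition of $\mathfrak C$ into standard dyadic intervals. Thompson's group $V$ is the group of all homeomorphisms $v$ of $\mathfrak C$ for which there are two standard dyadic partitions $(m_k\cdot\mathfrak C)_{1\le k\le n}$ and $(w_k\cdot\mathfrak C)_{1\le k\le n}$ with $v(m_k\cdot z)=w_k\cdot z$ for all $1\le k\le n$ and $z\in\mathfrak C$. For a group $\Gamma$ let $L\Gamma$ be the group, under pointwise multiplication, of all locally constant maps $\mathfrak C\to\Gamma$. Given $\alpha_0,\alpha_1\in\mathrm{Aut}(\Gamma)$, put $\alpha_m:=\alpha_{l_n}\circ\cdots\circ\alpha_{l_1}$ for a word $m=l_1\cdots l_n$. For $v\in V$ and $x\in\mathfrak C$ put $\tau_{v,x}:=\alpha_w^{-1}\circ\alpha_m$, where $m$ is any prefix of $x$ for which there is a word $w$ with $v(m\cdot z)=w\cdot z$ for all $z\in\mathfrak C$ (this does not depend on the choice of $m$). The formula $\pi_v(a)(vx)=\tau_{v,x}(a(x))$,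 for $v\in V$, $a\in L\Gamma$, $x\in\mathfrak C$, defines an action of $V$ on $L\Gamma$ by automorphisms. The resulting semidirect product $G(\Gamma,\alpha_0,\alpha_1):=L\Gamma\rtimes V$ is the fraction group of the triple $(\Gamma,\alpha_0,\alpha_1)$. **Theorem A.** Let $\Gamma,\tilde\Gamma$ be groups, $\alpha_0,\alpha_1\in\mathrm{Aut}(\Gamma)$ and $\tilde\alpha_0,\tilde\alpha_1\in\mathrm{Aut}(\tilde\Gamma)$. Put $G=G(\Gamma,\alpha_0,\alpha_1)$ and $\tilde G=G(\tilde\Gamma,\tilde\alpha_0,\tilde\alpha_1)$. 1. If $G\simeq\tilde G$, then $\Gamma\simeq\tilde\Gamma$. 2. If $\tilde\alpha_0$ and $\tilde\alpha_1$ are inner automorphisms, then $G\simeq\tilde G$ if and only if $\Gamma\simeq\tilde\Gamma$ and both $\alpha_0$ and $\alpha_1$ are inner automorphisms. 3. In particular, the untwisted fraction groups satisfy $G(\Gamma,\mathrm{id}_\Gamma,\mathrm{id}_\Gamma)\simeq G(\tilde\Gamma,\mathrm{id}_{\tilde\Gamma},\mathrm{id}_{\tilde\Gamma})$ if and only if $\Gamma\simeq\tilde\Gamma$.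 -/

import Mathlib

namespace DiscreteLoop

/-- The Cantor space `{0,1}^ℕ` with the product topology (`false` is the letter `0`, `true` is `1`). -/
abbrev Cantor : Type := ℕ → Bool

/-- The concatenation `m · x` of a finite word `m` and an infinite sequence `x`. -/
def app : List Bool → Cantor → Cantor
  | [], x => x
  | b :: m, x => fun n => Nat.casesOn n b (app m x)

/-- The standard dyadic interval of all sequences with prefix `m`. -/
def sdi (m : List Bool) : Set Cantor := Set.range (app m)

/-- `p` lists the words of a standard dyadic partition: each point of the Cantor space
lies in exactly one of the standard dyadic intervals `sdi (p k)`. -/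
def IsSDP {n : ℕ} (p : Fin n → List Bool) : Prop := ∀ x : Cantor, ∃! k, x ∈ sdi (p k)

/-- `v` carries the sequences with prefix `m` to those with prefix `w` by exchanging prefixes. -/
def Adapted (v : Cantor ≃ₜ Cantor) (m w : List Bool) : Prop := ∀ z, v (app m z) = app w z

/-- `v` maps a standard dyadic partition onto another one by exchanging prefixes. -/
def IsThompson (v : Cantor ≃ₜ Cantor) : Prop :=
  ∃ (n : ℕ) (p q : Fin n → List Bool), IsSDP p ∧ IsSDP q ∧ ∀ k, Adapted v (p k) (q k)

/-! ### Words and prefixes -/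

lemma app_append (m w : List Bool) (x : Cantor) : app (m ++ w) x = app m (app w x) := by
  induction m with
  | nil => rfl
  | cons b m ih => simp [app, ih]

lemma app_cons_inj {b c : Bool} {m w : List Bool} {x y : Cantor}
    (h : app (b :: m) x = app (c :: w) y) : b = c ∧ app m x = app w y :=
  ⟨congrFun h 0, funext fun n => congrFun h (n + 1)⟩

lemma app_injective (m : List Bool) : Function.Injective (app m) := by
  induction m with
  | nil => exact fun _ _ h => h
  | cons b m ih => exact fun _ _ h => ih (app_cons_inj h).2

lemma exists_word (N : ℕ) (x : Cantor) : ∃ m : List Bool, m.length = N ∧ ∃ z, x = app m z := by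
  induction N generalizing x with
  | zero => exact ⟨[], rfl, x, rfl⟩
  | succ N ih =>
    obtain ⟨m, hm, z, hz⟩ := ih fun n => x (n + 1)
    refine ⟨x 0 :: m, by simp [hm], z, funext fun n => ?_⟩
    cases n with
    | zero => rfl
    | succ n => exact congrFun hz n

lemma prefix_of_app_eq {m w : List Bool} {x y : Cantor} (h : app m x = app w y)
    (hl : m.length ≤ w.length) : ∃ r, w = m ++ r ∧ x = app r y := by
  induction m generalizing w with
  | nil => exact ⟨w, rfl, h⟩
  | cons b m ih =>
    cases w with
    | nil => simp at hl
    | cons c w =>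
      obtain ⟨hb, h'⟩ := app_cons_inj h
      obtain ⟨r, hr, hx⟩ := ih h' (by simpa using hl)
      exact ⟨r, by simp [hb, hr], hx⟩

lemma eq_of_app_eq {m w : List Bool} (h : ∀ z, app m z = app w z) : m = w := by
  induction m generalizing w with
  | nil =>
    cases w with
    | nil => rfl
    | cons c w => simpa [app] using congrFun (h fun _ => !c) 0
  | cons b m ih =>
    cases w with
    | nil => simpa [app] using congrFun (h fun _ => !b) 0
    | cons c w =>
      rw [(app_cons_inj (h fun _ => false)).1, ih fun z => (app_cons_inj (h z)).2]

lemma isOpen_sdi (m : List Bool) : IsOpen (sdi m) := by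
  induction m with
  | nil =>
    have : sdi [] = Set.univ := Set.eq_univ_of_forall fun x => ⟨x, rfl⟩
    rw [this]; exact isOpen_univ
  | cons b m ih =>
    have : sdi (b :: m) = (fun x : Cantor => x 0) ⁻¹' {b} ∩
        (fun (x : Cantor) (n : ℕ) => x (n + 1)) ⁻¹' sdi m := by
      ext x
      constructor
      · rintro ⟨z, rfl⟩
        exact ⟨rfl, z, rfl⟩
      · rintro ⟨h0, z, hz⟩
        refine ⟨z, funext fun n => ?_⟩
        cases n with
        | zero => exact h0.symm
        | succ n => exact congrFun hz n
    rw [this]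
    exact ((isOpen_discrete _).preimage (continuous_apply 0)).inter
      (ih.preimage (continuous_pi fun n => continuous_apply (n + 1)))

/-! ### Thompson's group `V` -/

lemma isThompson_of_level {v : Cantor ≃ₜ Cantor} (N : ℕ)
    (h : ∀ m : List Bool, m.length = N → ∃ w, Adapted v m w) : IsThompson v := by
  classical
  let e := Fintype.equivFin (List.Vector Bool N)
  let p : Fin (Fintype.card (List.Vector Bool N)) → List Bool := fun k => (e.symm k).1
  have hp : IsSDP p := by
    intro x
    obtain ⟨m, hm, z, rfl⟩ := exists_word N x
    let c : List.Vector Bool N := ⟨m, hm⟩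
    have hc : p (e c) = m := congrArg Subtype.val (e.symm_apply_apply c)
    refine ⟨e c, ⟨z, by rw [hc]⟩, ?_⟩
    rintro k ⟨y, hy⟩
    obtain ⟨r, hr, -⟩ := prefix_of_app_eq hy (by simp [p, hm, (e.symm k).2])
    have hlen := congrArg List.length hr
    have hk : (p k).length = N := (e.symm k).2
    have hr0 : r = [] := by
      rw [List.length_append, hm, hk] at hlen
      exact List.length_eq_zero_iff.1 (by omega)
    have hk' : e.symm k = c := Subtype.ext (by simpa [hr0] using hr.symm)
    exact (Equiv.symm_apply_eq e).1 hk'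
  choose q hq using fun k => h (p k) (e.symm k).2
  refine ⟨_, p, q, hp, fun x => ?_, hq⟩
  have key : ∀ k, x ∈ sdi (q k) ↔ v.symm x ∈ sdi (p k) := fun k =>
    ⟨fun ⟨z, hz⟩ => ⟨z, by rw [← hz, ← hq k z, v.symm_apply_apply]⟩,
      fun ⟨z, hz⟩ => ⟨z, by rw [← hq k z, hz, v.apply_symm_apply]⟩⟩
  simpa only [key] using hp (v.symm x)

lemma IsThompson.level {v : Cantor ≃ₜ Cantor} (hv : IsThompson v) :
    ∃ N : ℕ, ∀ m : List Bool, N ≤ m.length → ∃ w, Adapted v m w := by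
  obtain ⟨n, p, q, hp, -, h⟩ := hv
  refine ⟨Finset.univ.sup fun k => (p k).length, fun m hm => ?_⟩
  obtain ⟨k, ⟨y, hy⟩, -⟩ := hp (app m fun _ => false)
  obtain ⟨r, rfl, -⟩ := prefix_of_app_eq hy
    ((Finset.le_sup (f := fun k => (p k).length) (Finset.mem_univ k)).trans hm)
  exact ⟨q k ++ r, fun z => by rw [app_append, app_append, h k]⟩

/-- Thompson's group `V`, as a group of homeomorphisms of the Cantor space. -/
def thompsonV : Subgroup (Cantor ≃ₜ Cantor) where
  carrier := {v | IsThompson v}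
  one_mem' := isThompson_of_level 0 fun m _ => ⟨m, fun _ => rfl⟩
  mul_mem' := by
    rintro w v hw hv
    obtain ⟨N, hN⟩ := IsThompson.level hv
    obtain ⟨M, hM⟩ := IsThompson.level hw
    refine isThompson_of_level (N + M) fun m hm => ?_
    obtain ⟨u, hu⟩ := hN (m.take N) (by simp [hm])
    obtain ⟨t, ht⟩ := hM (u ++ m.drop N) (by simp [hm])
    refine ⟨t, fun z => ?_⟩
    rw [← ht z, app_append, ← hu, ← app_append, List.take_append_drop]
    rfl
  inv_mem' := by
    rintro v ⟨n, p, q, hp, hq, h⟩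
    refine ⟨n, q, p, hq, hp, fun k z => ?_⟩
    rw [← h k z]
    exact v.symm_apply_apply _

/-- Every point has a prefix `m` on which `v ∈ V` acts by exchanging `m` for a word `w`. -/
lemma exists_adapted (v : thompsonV) (x : Cantor) :
    ∃ mw : List Bool × List Bool, x ∈ sdi mw.1 ∧ Adapted v.1 mw.1 mw.2 := by
  obtain ⟨n, p, q, hp, -, h⟩ := v.2
  obtain ⟨k, hk, -⟩ := hp x
  exact ⟨(p k, q k), hk, h k⟩

/-! ### The twisted action of `V` on the discrete loop group -/

section Action

variable {Γ : Type*} [Group Γ]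

/-- `α_m = α_{l_n} ∘ ⋯ ∘ α_{l_1}` for a word `m = l_1 ⋯ l_n`. -/
def wordAut (α₀ α₁ : MulAut Γ) : List Bool → MulAut Γ
  | [] => 1
  | b :: m => wordAut α₀ α₁ m * bif b then α₁ else α₀

lemma wordAut_append (α₀ α₁ : MulAut Γ) (m w : List Bool) :
    wordAut α₀ α₁ (m ++ w) = wordAut α₀ α₁ w * wordAut α₀ α₁ m := by
  induction m with
  | nil => simp [wordAut]
  | cons b m ih => simp [wordAut, ih, mul_assoc]

/-- The twist `τ_{v,x} = α_w⁻¹ ∘ α_m`, where `m` is a prefix of `x` and `v` exchanges the prefix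
`m` for `w`; by `tau_eq` this does not depend on the choice of `m` and `w`. -/
noncomputable def tau (α₀ α₁ : MulAut Γ) (v : thompsonV) (x : Cantor) : MulAut Γ :=
  (wordAut α₀ α₁ (exists_adapted v x).choose.2)⁻¹ *
    wordAut α₀ α₁ (exists_adapted v x).choose.1

lemma tau_indep (α₀ α₁ : MulAut Γ) (v : Cantor ≃ₜ Cantor) {x : Cantor} {m w m' w' : List Bool}
    (hx : x ∈ sdi m) (h : Adapted v m w) (hx' : x ∈ sdi m') (h' : Adapted v m' w')
    (hl : m.length ≤ m'.length) :
    (wordAut α₀ α₁ w')⁻¹ * wordAut α₀ α₁ m' = (wordAut α₀ α₁ w)⁻¹ * wordAut α₀ α₁ m := by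
  obtain ⟨z, rfl⟩ := hx
  obtain ⟨z', hz'⟩ := hx'
  obtain ⟨r, rfl, -⟩ := prefix_of_app_eq hz'.symm hl
  have hw : w' = w ++ r := eq_of_app_eq fun y => by
    rw [← h' y, app_append, app_append, h]
  rw [hw, wordAut_append, wordAut_append]
  group

lemma tau_eq (α₀ α₁ : MulAut Γ) (v : thompsonV) {x : Cantor} {m w : List Bool}
    (hx : x ∈ sdi m) (h : Adapted v.1 m w) :
    tau α₀ α₁ v x = (wordAut α₀ α₁ w)⁻¹ * wordAut α₀ α₁ m := by
  have hc := (exists_adapted v x).choose_spec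
  rcases le_total m.length (exists_adapted v x).choose.1.length with hl | hl
  · exact tau_indep α₀ α₁ v.1 hx h hc.1 hc.2 hl
  · exact (tau_indep α₀ α₁ v.1 hc.1 hc.2 hx h hl).symm

lemma tau_one (α₀ α₁ : MulAut Γ) (x : Cantor) : tau α₀ α₁ 1 x = 1 := by
  have hx : x ∈ sdi [] := ⟨x, rfl⟩
  rw [tau_eq α₀ α₁ 1 (w := []) hx fun _ => rfl, inv_mul_cancel]

lemma tau_mul (α₀ α₁ : MulAut Γ) (w v : thompsonV) (x : Cantor) :
    tau α₀ α₁ (w * v) x = tau α₀ α₁ w (v.1 x) * tau α₀ α₁ v x := by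
  obtain ⟨⟨m, u⟩, ⟨z, hz⟩, hv⟩ := exists_adapted v x
  obtain ⟨N, hN⟩ := IsThompson.level w.2
  obtain ⟨r, hr, y, rfl⟩ := exists_word N z
  obtain ⟨t, ht⟩ := hN (u ++ r) (by simp [hr])
  have hx : x ∈ sdi (m ++ r) := ⟨y, by rw [app_append]; exact hz⟩
  have hv' : Adapted v.1 (m ++ r) (u ++ r) := fun a => by
    rw [app_append, app_append]; exact hv _
  have hvx : v.1 x ∈ sdi (u ++ r) := by
    obtain ⟨a, rfl⟩ := hx
    exact ⟨a, (hv' a).symm⟩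
  have hwv : Adapted (w * v).1 (m ++ r) t := fun a => by
    rw [← ht a, ← hv' a]; rfl
  rw [tau_eq α₀ α₁ _ hx hwv, tau_eq α₀ α₁ _ hvx ht, tau_eq α₀ α₁ _ hx hv']
  group

lemma isLocallyConstant_tau (α₀ α₁ : MulAut Γ) (v : thompsonV) :
    IsLocallyConstant (tau α₀ α₁ v) := by
  rw [IsLocallyConstant.iff_exists_open]
  intro x
  obtain ⟨⟨m, w⟩, hx, h⟩ := exists_adapted v x
  exact ⟨sdi m, isOpen_sdi m, hx, fun y hy => by
    rw [tau_eq α₀ α₁ v hy h, tau_eq α₀ α₁ v hx h]⟩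

variable (Γ) in
/-- The discrete loop group `LΓ`: locally constant maps from the Cantor space to `Γ`, with
pointwise multiplication. -/
abbrev LoopGroup : Type _ := LocallyConstant Cantor Γ

/-- `π_v(a)(y) = τ_{v,x}(a(x))` with `x = v⁻¹ y`. -/
noncomputable def act (α₀ α₁ : MulAut Γ) (v : thompsonV) (a : LoopGroup Γ) : LoopGroup Γ where
  toFun y := tau α₀ α₁ v (v.1.symm y) (a (v.1.symm y))
  isLocallyConstant :=
    ((isLocallyConstant_tau α₀ α₁ v).comp₂ a.isLocallyConstant fun t g => t g).comp_continuous
      v.1.symm.continuous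

lemma act_apply (α₀ α₁ : MulAut Γ) (v : thompsonV) (a : LoopGroup Γ) (x : Cantor) :
    act α₀ α₁ v a (v.1 x) = tau α₀ α₁ v x (a x) := by
  change tau α₀ α₁ v (v.1.symm (v.1 x)) (a (v.1.symm (v.1 x))) = _
  rw [v.1.symm_apply_apply]

lemma act_one (α₀ α₁ : MulAut Γ) (a : LoopGroup Γ) : act α₀ α₁ 1 a = a := by
  ext x
  have h := act_apply α₀ α₁ 1 a x
  rw [tau_one] at h
  exact h

lemma act_mul (α₀ α₁ : MulAut Γ) (w v : thompsonV) (a : LoopGroup Γ) :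
    act α₀ α₁ (w * v) a = act α₀ α₁ w (act α₀ α₁ v a) := by
  ext y
  obtain ⟨x, rfl⟩ := (w * v).1.surjective y
  rw [act_apply, tau_mul]
  change _ = act α₀ α₁ w (act α₀ α₁ v a) (w.1 (v.1 x))
  rw [act_apply, act_apply]
  rfl

/-- The twisted (Jones) action `π : V → Aut(LΓ)`, `π_v(a)(v x) = τ_{v,x}(a(x))`. -/
noncomputable def jonesAction (α₀ α₁ : MulAut Γ) : thompsonV →* MulAut (LoopGroup Γ) where
  toFun v :=
    { toFun := act α₀ α₁ v
      invFun := act α₀ α₁ v⁻¹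
      left_inv := fun a => by rw [← act_mul, inv_mul_cancel, act_one]
      right_inv := fun a => by rw [← act_mul, mul_inv_cancel, act_one]
      map_mul' := fun a b => by
        ext y
        exact map_mul (tau α₀ α₁ v (v.1.symm y)) _ _ }
  map_one' := by
    ext1 a
    exact act_one α₀ α₁ a
  map_mul' w v := by
    ext1 a
    exact act_mul α₀ α₁ w v a

/-- The fraction group `LΓ ⋊ V` of the triple `(Γ, α₀, α₁)`. -/
abbrev FractionGroup (α₀ α₁ : MulAut Γ) : Type _ :=
  LoopGroup Γ ⋊[jonesAction α₀ α₁] thompsonV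

/-- `α` is an inner automorphism, i.e. conjugation `h ↦ g h g⁻¹` by some `g`. -/
def IsInner (α : MulAut Γ) : Prop := ∃ g : Γ, α = MulAut.conj g

end Action

end DiscreteLoop

/-!
Let `θ` be an isomorphism from the fraction group of `(Γ, α₀, α₁)` to that of `(Δ, β₀, β₁)`. It maps
`LΓ` onto `LΔ`: the image of `LΓ` in `V` is a normal subgroup generated by two commuting normal
subgroups, the images of the loops supported on the two halves of the Cantor space. As `V` acts
nontrivially inside every open set, one of them is trivial, hence both are, being conjugate in `V`.
The induced automorphism of `V` is conjugation by a homeomorphism of the Cantor space, because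
disjointness and inclusion of supports can be recognised algebraically (Rubin).

Composed with this homeomorphism, `θ` becomes an isomorphism from `LΓ` to `LΔ` intertwining the
action of `V` on `LΓ` with one that moves values from `x` to `v x` by automorphisms of `Δ`. Loops
supported away from `x` have images whose value at `x` is central. Dividing these contributions out
of the values at `x` of the images of constant loops gives an isomorphism from `Γ` to `Δ` that
intertwines `τ_{v,x}` with the automorphism of `Δ` moving values from `x` to `v x`. If `x = bbb⋯`
and `v (b·z) = bb·z` for all `z`, then `τ_{v,x} = α_b⁻¹`, so `α_b` is inner as soon as `β₀` and `β₁`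
are.

Conversely, multiplying `α₀` and `α₁` by inner automorphisms perturbs the action of `V` on `LΓ` by
conjugation with a cocycle of loops, which does not change the semidirect product.
-/

namespace DiscreteLoop

open Topology MulAction SemidirectProduct
open scoped commutatorElement

/-! ### Elements supported in a set -/

section Support

variable {G X : Type*} [Group G] [MulAction G X]

variable (G) in
/-- The rigid stabilizer of `U`: the elements of `G` which move no point outside `U`. -/
def rigidStabilizer (U : Set X) : Subgroup G := fixingSubgroup G Uᶜ

/-- `f` moves `U` off itself. -/
def Displaces (f : G) (U : Set X) : Prop := ∀ x ∈ U, f • x ∉ U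

variable {f g a b d : G} {U W : Set X} {x : X}

lemma mem_rigidStabilizer : g ∈ rigidStabilizer G U ↔ ∀ x ∉ U, g • x = x :=
  mem_fixingSubgroup_iff G

lemma smul_eq_of_mem_rigidStabilizer (hg : g ∈ rigidStabilizer G U) (hx : x ∉ U) : g • x = x :=
  mem_rigidStabilizer.1 hg x hx

lemma mem_of_mem_rigidStabilizer (hg : g ∈ rigidStabilizer G U) (hx : g • x ≠ x) : x ∈ U :=
  not_imp_comm.1 (smul_eq_of_mem_rigidStabilizer hg) hx

lemma rigidStabilizer_mono (h : U ⊆ W) : rigidStabilizer G U ≤ rigidStabilizer G W :=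
  fixingSubgroup_antitone G X (Set.compl_subset_compl.2 h)

lemma commutator_mem_rigidStabilizer (ha : a ∈ rigidStabilizer G U)
    (hb : b ∈ rigidStabilizer G U) : ⁅a, b⁆ ∈ rigidStabilizer G U :=
  Subgroup.commutator_le_self _ (Subgroup.commutator_mem_commutator ha hb)

lemma conj_mem_rigidStabilizer (hg : g ∈ rigidStabilizer G U) (h : ∀ x ∈ U, f • x ∈ W) :
    f * g * f⁻¹ ∈ rigidStabilizer G W :=
  mem_rigidStabilizer.2 fun x hx => by
    have hU : f⁻¹ • x ∉ U := fun hU => hx (by simpa only [smul_inv_smul] using h _ hU)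
    rw [mul_smul, mul_smul, smul_eq_of_mem_rigidStabilizer hg hU, smul_inv_smul]

lemma smul_mem_of_mem_rigidStabilizer (hg : g ∈ rigidStabilizer G U) (hx : x ∈ U) :
    g • x ∈ U := by
  by_contra hgx
  exact hgx ((smul_left_cancel g (smul_eq_of_mem_rigidStabilizer hg hgx)).symm ▸ hx)

lemma Displaces.mono (hf : Displaces f W) (h : U ⊆ W) : Displaces f U :=
  fun x hx hfx => hf x (h hx) (h hfx)

variable [FaithfulSMul G X]

variable (X) in
lemma exists_smul_ne (hg : g ≠ 1) : ∃ x : X, g • x ≠ x := by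
  by_contra! h
  exact hg (FaithfulSMul.eq_of_smul_eq_smul fun x : X => by rw [h x, one_smul])

lemma commute_of_mem_rigidStabilizer_compl (hf : f ∈ rigidStabilizer G U)
    (hg : g ∈ rigidStabilizer G Uᶜ) : Commute f g := by
  refine FaithfulSMul.eq_of_smul_eq_smul fun x : X => ?_
  rw [mul_smul, mul_smul]
  by_cases hx : x ∈ U
  · rw [smul_eq_of_mem_rigidStabilizer hg (not_not_intro hx),
      smul_eq_of_mem_rigidStabilizer hg
        (not_not_intro (smul_mem_of_mem_rigidStabilizer hf hx))]
  · rw [smul_eq_of_mem_rigidStabilizer hf hx,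
      smul_eq_of_mem_rigidStabilizer hf (smul_mem_of_mem_rigidStabilizer hg hx)]

variable (X) in
lemma exists_smul_ne_of_not_commute (h : ¬ Commute f g) : ∃ x : X, f • x ≠ x ∧ g • x ≠ x := by
  by_contra! H
  exact h (commute_of_mem_rigidStabilizer_compl (U := {x : X | f • x ≠ x})
    (mem_rigidStabilizer.2 fun _ => not_not.1)
    (mem_rigidStabilizer.2 fun x hx => H x (not_not.1 hx)))

lemma Displaces.eq_one_of_commute (hf : Displaces f U) (hd : d ∈ rigidStabilizer G U)
    (h : Commute d f) : d = 1 := by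
  refine FaithfulSMul.eq_of_smul_eq_smul fun x : X => ?_
  rw [one_smul]
  by_cases hx : x ∈ U
  · have hdf : f • d • x = f • x := by
      rw [← mul_smul, ← h.eq, mul_smul, smul_eq_of_mem_rigidStabilizer hd (hf x hx)]
    exact smul_left_cancel f hdf
  · exact smul_eq_of_mem_rigidStabilizer hd hx

lemma Displaces.commutator_commutator (hf : Displaces f U) (ha : a ∈ rigidStabilizer G U)
    (hb : b ∈ rigidStabilizer G U) : ⁅⁅a, f⁆, b⁆ = ⁅a, b⁆ := by
  have hcb : Commute b (f * a⁻¹ * f⁻¹) :=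
    commute_of_mem_rigidStabilizer_compl hb (conj_mem_rigidStabilizer (inv_mem ha) hf)
  calc ⁅⁅a, f⁆, b⁆ = a * ((f * a⁻¹ * f⁻¹) * b) * (f * a⁻¹ * f⁻¹)⁻¹ * a⁻¹ * b⁻¹ := by group
    _ = a * (b * (f * a⁻¹ * f⁻¹)) * (f * a⁻¹ * f⁻¹)⁻¹ * a⁻¹ * b⁻¹ := by rw [hcb.eq]
    _ = ⁅a, b⁆ := by group

lemma Displaces.commutator_mem {N : Subgroup G} (hf : Displaces f U) (hfN : f ∈ N)
    (ha : a ∈ rigidStabilizer G U) (hb : b ∈ rigidStabilizer G U)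
    (haN : a ∈ Subgroup.normalizer (N : Set G)) (hbN : b ∈ Subgroup.normalizer (N : Set G)) :
    ⁅a, b⁆ ∈ N := by
  have haf : ⁅a, f⁆ ∈ N := mul_mem ((Subgroup.mem_normalizer_iff.1 haN f).1 hfN) (inv_mem hfN)
  have hconj : b * ⁅a, f⁆⁻¹ * b⁻¹ ∈ N := (Subgroup.mem_normalizer_iff.1 hbN _).1 (inv_mem haf)
  rw [← hf.commutator_commutator ha hb, commutatorElement_def ⁅a, f⁆, mul_assoc, mul_assoc,
    ← mul_assoc b]
  exact mul_mem haf hconj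

end Support

/-! ### Locally moving actions -/

/-- Every nonempty open set supports an element of `G` whose twelfth power is nontrivial; the
exponent is the least common multiple of the powers `1, …, 4` used for algebraic disjointness. -/
def LocallyMoving (G X : Type*) [Group G] [TopologicalSpace X] [MulAction G X] : Prop :=
  ∀ U : Set X, IsOpen U → U.Nonempty → ∃ g ∈ rigidStabilizer G U, g ^ 12 ≠ 1

section LocallyMoving

variable {G X : Type*} [Group G] [TopologicalSpace X] [MulAction G X]

lemma LocallyMoving.exists_ne_one (hG : LocallyMoving G X) {U : Set X} (hU : IsOpen U)
    (hne : U.Nonempty) : ∃ g ∈ rigidStabilizer G U, g ≠ 1 := by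
  obtain ⟨g, hg, h12⟩ := hG U hU hne
  exact ⟨g, hg, fun h => h12 (by rw [h, one_pow])⟩

lemma exists_smul_ne_and_smul_mem [FaithfulSMul G X] {M : Subgroup G} [hM : M.Normal]
    (hX : ∀ p x : X, x ≠ p → {p}ᶜ ⊆ closure (orbit (stabilizer G p) x)) {f : G} (hf : f ∈ M)
    (hf1 : f ≠ 1) {B : Set X} (hB : IsOpen B) (hne : B.Nonempty) :
    ∃ x : X, f • x ≠ x ∧ ∃ γ ∈ M, γ • x ∈ B := by
  obtain ⟨y, hy⟩ := hne
  by_cases hfy : f • y = y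
  · obtain ⟨x, hx⟩ := exists_smul_ne X hf1
    have hyp : y ≠ f • x := fun h => hx (smul_left_cancel f (h ▸ hfy))
    obtain ⟨_, hgx, ⟨g, hg⟩, rfl⟩ := mem_closure_iff.1 (hX (f • x) x hx.symm hyp) B hB hy
    -- As `g` fixes `f • x`, the conjugate of `f⁻¹` by `g` maps `f • x` to `g • x`.
    refine ⟨x, hx, g * f⁻¹ * g⁻¹ * f, mul_mem (hM.conj_mem _ (inv_mem hf) g) hf, ?_⟩
    have hgp : g⁻¹ • f • x = f • x := inv_smul_eq_iff.2 (mem_stabilizer_iff.1 hg).symm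
    rwa [mul_smul, mul_smul, mul_smul, hgp, inv_smul_smul]
  · exact ⟨y, hfy, 1, one_mem M, by rwa [one_smul]⟩

variable [T2Space X] [ContinuousConstSMul G X]

lemma exists_forall_displaces {F : Set G} (hF : F.Finite) {x : X} (hx : ∀ f ∈ F, f • x ≠ x)
    {W : Set X} (hW : W ∈ 𝓝 x) :
    ∃ U, IsOpen U ∧ x ∈ U ∧ U ⊆ W ∧ ∀ f ∈ F, Displaces f U := by
  choose! A B hA hB hfA hxB hAB using fun f hf => t2_separation (hx f hf)
  refine ⟨interior W ∩ ⋂ f ∈ F, (f • ·) ⁻¹' A f ∩ B f, ?_, ?_, fun y hy => interior_subset hy.1, ?_⟩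
  · exact isOpen_interior.inter (hF.isOpen_biInter fun f hf =>
      ((hA f hf).preimage (continuous_const_smul f)).inter (hB f hf))
  · exact ⟨mem_interior_iff_mem_nhds.2 hW, Set.mem_iInter₂.2 fun f hf => ⟨hfA f hf, hxB f hf⟩⟩
  · exact fun f hf y hy hfy => Set.disjoint_left.1 (hAB f hf) (Set.mem_iInter₂.1 hy.2 f hf).1
      (Set.mem_iInter₂.1 hfy.2 f hf).2

lemma exists_displaces {f : G} {x : X} (hx : f • x ≠ x) {W : Set X} (hW : W ∈ 𝓝 x) :
    ∃ U, IsOpen U ∧ x ∈ U ∧ U ⊆ W ∧ Displaces f U := by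
  simpa only [Set.mem_singleton_iff, forall_eq] using
    exists_forall_displaces (Set.finite_singleton f) (by simpa using hx) hW

variable [FaithfulSMul G X]

lemma exists_subset_displaces {d : G} (hd1 : d ≠ 1) {U : Set X} (hU : IsOpen U)
    (hd : d ∈ rigidStabilizer G U) : ∃ W ⊆ U, IsOpen W ∧ W.Nonempty ∧ Displaces d W := by
  obtain ⟨x, hx⟩ := exists_smul_ne X hd1
  obtain ⟨W, hW, hxW, hWU, hdW⟩ :=
    exists_displaces hx (hU.mem_nhds (mem_of_mem_rigidStabilizer hd hx))
  exact ⟨W, hWU, hW, ⟨x, hxW⟩, hdW⟩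

lemma LocallyMoving.exists_commutator_ne_one (hG : LocallyMoving G X) {U : Set X}
    (hU : IsOpen U) (hne : U.Nonempty) :
    ∃ a ∈ rigidStabilizer G U, ∃ b ∈ rigidStabilizer G U, ⁅a, b⁆ ≠ 1 := by
  obtain ⟨a, ha, ha1⟩ := hG.exists_ne_one hU hne
  obtain ⟨W, hWU, hW, hWne, haW⟩ := exists_subset_displaces ha1 hU ha
  obtain ⟨b, hb, hb1⟩ := hG.exists_ne_one hW hWne
  exact ⟨a, ha, b, rigidStabilizer_mono hWU hb, fun h =>
    hb1 (haW.eq_one_of_commute hb (commutatorElement_eq_one_iff_commute.1 h).symm)⟩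

lemma LocallyMoving.exists_commutator_commutator_ne_one (hG : LocallyMoving G X) {U : Set X}
    (hU : IsOpen U) (hne : U.Nonempty) :
    ∃ a ∈ rigidStabilizer G U, ∃ b ∈ rigidStabilizer G U,
      ∃ a' ∈ rigidStabilizer G U, ∃ b' ∈ rigidStabilizer G U, ⁅⁅a, b⁆, ⁅a', b'⁆⁆ ≠ 1 := by
  obtain ⟨a, ha, b, hb, hab⟩ := hG.exists_commutator_ne_one hU hne
  obtain ⟨W, hWU, hW, hWne, hdW⟩ :=
    exists_subset_displaces hab hU (commutator_mem_rigidStabilizer ha hb)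
  obtain ⟨a', ha', b', hb', hab'⟩ := hG.exists_commutator_ne_one hW hWne
  exact ⟨a, ha, b, hb, a', rigidStabilizer_mono hWU ha', b', rigidStabilizer_mono hWU hb',
    fun h => hab' (hdW.eq_one_of_commute (commutator_mem_rigidStabilizer ha' hb')
      (commutatorElement_eq_one_iff_commute.1 h).symm)⟩

section Subnormal

variable {M M₁ M₂ : Subgroup G} [M.Normal]

lemma LocallyMoving.exists_mem_ne_one (hG : LocallyMoving G X) (h₁ : M₁ ≤ M)
    (hn : M ≤ Subgroup.normalizer (M₁ : Set G)) {f : G} (hf : f ∈ M₁) {U : Set X} (hU : IsOpen U)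
    (hne : U.Nonempty) (hfU : Displaces f U) : ∃ h ∈ M₁, h ∈ rigidStabilizer G U ∧ h ≠ 1 := by
  obtain ⟨a, ha, b, hb, a', ha', b', hb', h1⟩ := hG.exists_commutator_commutator_ne_one hU hne
  have hM : ∀ c ∈ rigidStabilizer G U, ∀ d ∈ rigidStabilizer G U,
      ⁅c, d⁆ ∈ Subgroup.normalizer (M₁ : Set G) := fun c hc d hd =>
    hn (hfU.commutator_mem (h₁ hf) hc hd (by simp [Subgroup.normalizer_eq_top])
      (by simp [Subgroup.normalizer_eq_top]))
  have hab := commutator_mem_rigidStabilizer ha hb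
  have hab' := commutator_mem_rigidStabilizer ha' hb'
  exact ⟨_, hfU.commutator_mem hf hab hab' (hM a ha b hb) (hM a' ha' b' hb'),
    commutator_mem_rigidStabilizer hab hab', h1⟩

theorem LocallyMoving.eq_bot_or_eq_bot_of_commute (hG : LocallyMoving G X)
    (hX : ∀ p x : X, x ≠ p → {p}ᶜ ⊆ closure (orbit (stabilizer G p) x)) (h₁ : M₁ ≤ M)
    (hn : M ≤ Subgroup.normalizer (M₁ : Set G)) (hc : ∀ a ∈ M₁, ∀ b ∈ M₂, Commute a b) :
    M₁ = ⊥ ∨ M₂ = ⊥ := by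
  by_contra! hne
  obtain ⟨f, hf, hf1⟩ := M₁.bot_or_exists_ne_one.resolve_left hne.1
  obtain ⟨k, hk, hk1⟩ := M₂.bot_or_exists_ne_one.resolve_left hne.2
  obtain ⟨y, hy⟩ := exists_smul_ne X hk1
  obtain ⟨B, hB, hyB, -, hkB⟩ := exists_displaces hy Filter.univ_mem
  obtain ⟨x, hfx, γ, hγ, hγx⟩ := exists_smul_ne_and_smul_mem hX (h₁ hf) hf1 hB ⟨y, hyB⟩
  obtain ⟨U, hU, hxU, hUB, hfU⟩ :=
    exists_displaces hfx ((hB.preimage (continuous_const_smul γ)).mem_nhds hγx)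
  obtain ⟨h, hh, hhU, hh1⟩ := hG.exists_mem_ne_one h₁ hn hf hU ⟨x, hxU⟩ hfU
  have hconj : γ * h * γ⁻¹ ∈ M₁ := (Subgroup.mem_normalizer_iff.1 (hn hγ) h).1 hh
  exact hh1 (conj_eq_one_iff.1
    (hkB.eq_one_of_commute (conj_mem_rigidStabilizer hhU hUB) (hc _ hconj k hk)))

end Subnormal

end LocallyMoving

/-! ### Algebraic disjointness -/

/-- Rubin's algebraic disjointness, a purely group-theoretic substitute for disjointness of
supports: whatever fails to commute with `f` yields a nontrivial double commutator commuting with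
`g`. It is not symmetric in `g` and `f`. -/
def AlgDisjoint {G : Type*} [Group G] (g f : G) : Prop :=
  ∀ h, ¬ Commute f h → ∃ f₁ f₂, Commute f₁ g ∧ Commute f₂ g ∧
    Commute ⁅⁅f₁, h⁆, f₂⁆ g ∧ ⁅⁅f₁, h⁆, f₂⁆ ≠ 1

lemma AlgDisjoint.map {G H : Type*} [Group G] [Group H] (σ : G ≃* H) {g f : G}
    (h : AlgDisjoint g f) : AlgDisjoint (σ g) (σ f) := by
  intro k hk
  obtain ⟨f₁, f₂, h₁, h₂, hc, hne⟩ := h (σ.symm k) fun hc => hk (by simpa using hc.map σ)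
  have hσ : ⁅⁅σ f₁, k⁆, σ f₂⁆ = σ ⁅⁅f₁, σ.symm k⁆, f₂⁆ := by
    simp only [map_commutatorElement, MulEquiv.apply_symm_apply]
  exact ⟨σ f₁, σ f₂, h₁.map σ, h₂.map σ, hσ ▸ hc.map σ, hσ ▸ (map_ne_one_iff σ σ.injective).2 hne⟩

section Pigeonhole

open scoped Pointwise

variable {G X : Type*} [Group G] [MulAction G X] {U : Set X}

lemma eq_one_of_displaces_pow [FaithfulSMul G X] {ι : Type*} [Fintype ι] {d g : G} {e : ι → G}
    (hd : d ∈ rigidStabilizer G (⋃ i, e i • U)) (hdg : Commute d g) (he : ∀ i, Commute (e i) g)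
    (hg : ∀ k ∈ Set.Icc 1 (Fintype.card ι), Displaces (g ^ k) U) : d = 1 := by
  by_contra hd1
  obtain ⟨s, hs⟩ := exists_smul_ne X hd1
  have hmem : ∀ n : Fin (Fintype.card ι + 1), ∃ i, g ^ (n : ℕ) • s ∈ e i • U := fun n => by
    refine Set.mem_iUnion.1 (mem_of_mem_rigidStabilizer hd fun hn => hs ?_)
    rw [← mul_smul, (hdg.pow_right (n : ℕ)).eq, mul_smul] at hn
    exact smul_left_cancel _ hn
  choose i hi using hmem
  obtain ⟨a, b, hab, hiab⟩ := Fintype.exists_ne_map_eq_of_card_lt i (by simp)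
  wlog hlt : a < b generalizing a b
  · exact this b a hab.symm hiab.symm (lt_of_le_of_ne (not_lt.1 hlt) hab.symm)
  have hlt' : (a : ℕ) < b := hlt
  have ha := Set.mem_smul_set_iff_inv_smul_mem.1 (hi a)
  have hb := Set.mem_smul_set_iff_inv_smul_mem.1 (hi b)
  rw [← hiab, ← Nat.sub_add_cancel hlt'.le, pow_add, mul_smul, ← mul_smul,
    ((he (i a)).inv_left.pow_right _).eq, mul_smul] at hb
  exact hg (b - a) ⟨by omega, by omega⟩ _ ha hb

lemma commutator_commutator_mem_rigidStabilizer {k : G} (hk : k ∈ rigidStabilizer G U)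
    (f₁ f₂ : G) : ⁅⁅f₁, k⁆, f₂⁆ ∈ rigidStabilizer G (⋃ i, ![1, f₁, f₂, f₂ * f₁] i • U) := by
  have hU : ∀ x ∈ U, ∀ f : G, f • x ∈ f • U := fun _ hx f => Set.smul_mem_smul_set hx
  have hc : ⁅f₁, k⁆ ∈ rigidStabilizer G (U ∪ f₁ • U) :=
    mul_mem (conj_mem_rigidStabilizer hk fun x hx => Or.inr (hU x hx f₁))
      (rigidStabilizer_mono Set.subset_union_left (inv_mem hk))
  rw [commutatorElement_def, mul_assoc, mul_assoc, ← mul_assoc f₂]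
  refine mul_mem (rigidStabilizer_mono (Set.union_subset ?_ ?_) hc)
    (conj_mem_rigidStabilizer (inv_mem hc) ?_)
  · exact fun x hx => Set.mem_iUnion.2 ⟨0, by simpa using hx⟩
  · exact fun x hx => Set.mem_iUnion.2 ⟨1, hx⟩
  · rintro x (hx | hx)
    · exact Set.mem_iUnion.2 ⟨2, hU x hx f₂⟩
    · exact Set.mem_iUnion.2 ⟨3, mul_smul f₂ f₁ U ▸ Set.smul_mem_smul_set hx⟩

end Pigeonhole

section ClosedSupport

variable {G X : Type*} [Group G] [TopologicalSpace X] [MulAction G X]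

variable (X) in
/-- The closure of the set of points moved by `g`. -/
def closedSupport (g : G) : Set X := closure {x | g • x ≠ x}

lemma closedSupport_subset_iff {g : G} {U : Set X} (hU : IsClosed U) :
    closedSupport X g ⊆ U ↔ g ∈ rigidStabilizer G U :=
  hU.closure_subset_iff.trans
    ⟨fun h => mem_rigidStabilizer.2 fun _ hx => not_not.1 fun hgx => hx (h hgx),
      fun h _ => mem_of_mem_rigidStabilizer h⟩

lemma isClosed_closedSupport (g : G) : IsClosed (closedSupport X g) := isClosed_closure

lemma notMem_closedSupport_iff {g : G} {x : X} :
    x ∉ closedSupport X g ↔ ∀ᶠ y in 𝓝 x, g • y = y := by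
  simp only [closedSupport, mem_closure_iff_frequently, Filter.not_frequently, Set.mem_ofPred_eq,
    not_not]

lemma closedSupport_nonempty_iff [FaithfulSMul G X] {g : G} :
    (closedSupport X g).Nonempty ↔ g ≠ 1 := by
  rw [closedSupport, closure_nonempty_iff]
  refine ⟨?_, exists_smul_ne X⟩
  rintro ⟨x, hx⟩ rfl
  exact hx (one_smul G x)

lemma closedSupport_eq_preimage {H Y : Type*} [Group H] [TopologicalSpace Y] [MulAction H Y]
    (φ : X ≃ₜ Y) {g : G} {h : H} (hφ : ∀ x, φ (g • x) = h • φ x) :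
    closedSupport X g = φ ⁻¹' closedSupport Y h := by
  rw [closedSupport, closedSupport, φ.preimage_closure]
  simp only [Set.preimage_ofPred_eq, ← hφ, ne_eq, φ.injective.eq_iff]

lemma smul_mem_closedSupport_iff [ContinuousConstSMul G X] {f g : G} {x : X} :
    f • x ∈ closedSupport X g ↔ x ∈ closedSupport X (f⁻¹ * g * f) := by
  have hf : ∀ y : X, f • (f⁻¹ * g * f) • y = g • f • y := fun y => by
    rw [mul_assoc, mul_smul, smul_inv_smul, mul_smul]
  rw [closedSupport_eq_preimage (Homeomorph.smul f) hf]
  exact Iff.rfl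

end ClosedSupport

section Rubin

variable {G X : Type*} [Group G] [TopologicalSpace X] [T2Space X] [MulAction G X]
  [ContinuousConstSMul G X]

lemma smul_eq_of_mem_closedSupport {g f : G} (h : ∀ x : X, f • x ≠ x → g • x = x) {x : X}
    (hx : x ∈ closedSupport X f) : g • x = x :=
  closure_minimal (t := {x : X | g • x = x}) h
    (isClosed_eq (continuous_const_smul g) continuous_id) hx

lemma exists_displaces_pow {g : G} {x : X} (hx : g ^ 12 • x ≠ x) {W : Set X} (hW : W ∈ 𝓝 x) :
    ∃ U, IsOpen U ∧ x ∈ U ∧ U ⊆ W ∧ ∀ k ∈ Set.Icc 1 4, Displaces (g ^ k) U := by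
  have hne : ∀ f ∈ (g ^ ·) '' Set.Icc 1 4, f • x ≠ x := by
    rintro _ ⟨k, ⟨h₁, h₄⟩, rfl⟩ hk
    obtain ⟨l, hl⟩ : k ∣ 12 := by interval_cases k <;> decide
    rw [hl, pow_mul] at hx
    exact hx (pow_mem (S := stabilizer G x) hk l)
  obtain ⟨U, hU, hxU, hUW, hd⟩ := exists_forall_displaces ((Set.finite_Icc 1 4).image _) hne hW
  exact ⟨U, hU, hxU, hUW, fun k hk => hd _ (Set.mem_image_of_mem _ hk)⟩

variable [FaithfulSMul G X]

lemma LocallyMoving.algDisjoint (hG : LocallyMoving G X) {g f : G}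
    (h : ∀ x : X, f • x ≠ x → g • x = x) : AlgDisjoint g f := by
  intro k hk
  obtain ⟨x, hfx, hkx⟩ := exists_smul_ne_of_not_commute X hk
  have hopen : IsOpen {x : X | f • x ≠ x} :=
    isOpen_ne_fun (continuous_const_smul f) continuous_id
  obtain ⟨U, hU, hxU, hUf, hkU⟩ := exists_displaces hkx (hopen.mem_nhds hfx)
  obtain ⟨a, ha, b, hb, hab⟩ := hG.exists_commutator_ne_one hU ⟨x, hxU⟩
  have hg : g ∈ rigidStabilizer G Uᶜ :=
    mem_rigidStabilizer.2 fun y hy => h y (hUf (Set.not_notMem.1 hy))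
  have hcomm : ∀ c ∈ rigidStabilizer G U, Commute c g :=
    fun c hc => commute_of_mem_rigidStabilizer_compl hc hg
  refine ⟨a, b, hcomm a ha, hcomm b hb, ?_⟩
  rw [hkU.commutator_commutator ha hb]
  exact ⟨hcomm _ (commutator_mem_rigidStabilizer ha hb), hab⟩

lemma LocallyMoving.pow_smul_eq_of_algDisjoint (hG : LocallyMoving G X) {g f : G}
    (h : AlgDisjoint g f) {x : X} (hx : f • x ≠ x) : g ^ 12 • x = x := by
  by_contra hgx
  obtain ⟨W, hW, hxW, -, hfW⟩ := exists_displaces hx Filter.univ_mem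
  obtain ⟨U, hU, hxU, hUW, hgU⟩ := exists_displaces_pow hgx (hW.mem_nhds hxW)
  obtain ⟨k, hk, hk1⟩ := hG.exists_ne_one hU ⟨x, hxU⟩
  obtain ⟨f₁, f₂, h₁, h₂, hc, hne⟩ := h k fun hfk =>
    hk1 ((hfW.mono hUW).eq_one_of_commute hk hfk.symm)
  refine hne (eq_one_of_displaces_pow (commutator_commutator_mem_rigidStabilizer hk f₁ f₂) hc
    (fun i => ?_) (by simpa using hgU))
  fin_cases i
  exacts [Commute.one_left g, h₁, h₂, h₂.mul_left h₁]

lemma LocallyMoving.mem_rigidStabilizer_closedSupport_iff (hG : LocallyMoving G X) {h f : G} :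
    h ∈ rigidStabilizer G (closedSupport X f) ↔ ∀ g, AlgDisjoint g f → Commute h (g ^ 12) := by
  refine ⟨fun hh g hg => ?_, fun H => mem_rigidStabilizer.2 fun x hx => ?_⟩
  · refine commute_of_mem_rigidStabilizer_compl hh (mem_rigidStabilizer.2 fun x hx => ?_)
    exact smul_eq_of_mem_closedSupport (fun y => hG.pow_smul_eq_of_algDisjoint hg)
      (Set.not_notMem.1 hx)
  · by_contra hhx
    obtain ⟨U, hU, hxU, hUf, hhU⟩ :=
      exists_displaces hhx ((isClosed_closedSupport f).isOpen_compl.mem_nhds hx)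
    obtain ⟨g, hg, hg12⟩ := hG U hU ⟨x, hxU⟩
    have hgf : AlgDisjoint g f := hG.algDisjoint fun y hy =>
      smul_eq_of_mem_rigidStabilizer hg fun hyU => hUf hyU (subset_closure hy)
    exact hg12 (hhU.eq_one_of_commute (pow_mem hg 12) (H g hgf).symm)

end Rubin

/-! ### Spatial reconstruction -/

section Reconstruction

open TopologicalSpace

variable {G X : Type*} [Group G] [TopologicalSpace X] [MulAction G X]
variable {H Y : Type*} [Group H] [TopologicalSpace Y] [MulAction H Y]

variable (G X) in
/-- The action is locally moving and the closed supports of its elements form a basis of the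
topology. In particular all closed supports are open. -/
structure HasSupportBasis : Prop where
  locallyMoving : LocallyMoving G X
  isTopologicalBasis : IsTopologicalBasis (Set.range (closedSupport X : G → Set X))

lemma HasSupportBasis.isOpen_closedSupport (hG : HasSupportBasis G X) (g : G) :
    IsOpen (closedSupport X g) :=
  hG.isTopologicalBasis.isOpen (Set.mem_range_self g)

lemma HasSupportBasis.exists_mem_closedSupport_subset (hG : HasSupportBasis G X)
    {U : Set X} (hU : IsOpen U) {x : X} (hx : x ∈ U) :
    ∃ g : G, x ∈ closedSupport X g ∧ closedSupport X g ⊆ U := by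
  obtain ⟨_, ⟨g, rfl⟩, h⟩ := hG.isTopologicalBasis.exists_subset_of_mem_open hx hU
  exact ⟨g, h⟩

lemma HasSupportBasis.disjoint_closedSupport_iff [FaithfulSMul G X] (hG : HasSupportBasis G X)
    {g f : G} :
    Disjoint (closedSupport X g) (closedSupport X f) ↔
      ∀ t : G, closedSupport X t ⊆ closedSupport X g → closedSupport X t ⊆ closedSupport X f →
        t = 1 := by
  refine ⟨fun h t htg htf => ?_, fun h => Set.disjoint_left.2 fun x hxg hxf => ?_⟩
  · by_contra ht
    obtain ⟨x, hx⟩ := (closedSupport_nonempty_iff (X := X)).2 ht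
    exact Set.disjoint_left.1 h (htg hx) (htf hx)
  · obtain ⟨t, hxt, ht⟩ := hG.exists_mem_closedSupport_subset
      ((hG.isOpen_closedSupport g).inter (hG.isOpen_closedSupport f)) ⟨hxg, hxf⟩
    rw [Set.subset_inter_iff] at ht
    exact closedSupport_nonempty_iff.1 ⟨x, hxt⟩ (h t ht.1 ht.2)

/-- The points `x` and `y` lie in the closed supports of the same elements, under the
identification `σ` of the groups. -/
def Corresponds (σ : G ≃* H) (x : X) (y : Y) : Prop :=
  ∀ g, y ∈ closedSupport Y (σ g) ↔ x ∈ closedSupport X g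

namespace Corresponds

variable {σ : G ≃* H} {x : X} {y y' : Y}

lemma symm (h : Corresponds σ x y) : Corresponds σ.symm y x := fun g => by
  rw [← h, σ.apply_symm_apply]

lemma smul [ContinuousConstSMul G X] [ContinuousConstSMul H Y] (h : Corresponds σ x y) (g : G) :
    Corresponds σ (g • x) (σ g • y) := fun k => by
  rw [smul_mem_closedSupport_iff, smul_mem_closedSupport_iff, ← h, map_mul, map_mul, map_inv]

lemma eq [T1Space Y] (hH : HasSupportBasis H Y) (h : Corresponds σ x y)
    (h' : Corresponds σ x y') : y = y' := by
  by_contra hne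
  obtain ⟨t, hyt, ht⟩ := hH.exists_mem_closedSupport_subset (isOpen_ne (x := y')) hne
  obtain ⟨g, rfl⟩ := σ.surjective t
  exact ht ((h' g).2 ((h g).1 hyt)) rfl

end Corresponds

lemma continuous_of_corresponds (hG : HasSupportBasis G X) (hH : HasSupportBasis H Y)
    {σ : G ≃* H} {f : X → Y} (hf : ∀ x, Corresponds σ x (f x)) : Continuous f := by
  refine hH.isTopologicalBasis.continuous_iff.2 ?_
  rintro _ ⟨h, rfl⟩
  obtain ⟨g, rfl⟩ := σ.surjective h
  have hpre : f ⁻¹' closedSupport Y (σ g) = closedSupport X g := Set.ext fun x => hf x g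
  exact hpre ▸ hG.isOpen_closedSupport g

variable [T2Space X] [ContinuousConstSMul G X] [FaithfulSMul G X]
variable [T2Space Y] [ContinuousConstSMul H Y] [FaithfulSMul H Y]

lemma closedSupport_map_subset (hG : LocallyMoving G X) (hH : LocallyMoving H Y) (σ : G ≃* H)
    {g f : G} (h : closedSupport X g ⊆ closedSupport X f) :
    closedSupport Y (σ g) ⊆ closedSupport Y (σ f) := by
  rw [closedSupport_subset_iff (isClosed_closedSupport _),
    LocallyMoving.mem_rigidStabilizer_closedSupport_iff ‹_›] at h ⊢
  intro k hk
  have hfk : AlgDisjoint (σ.symm k) f := by simpa using hk.map σ.symm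
  simpa using (h _ hfk).map σ

lemma closedSupport_map_subset_iff (hG : LocallyMoving G X) (hH : LocallyMoving H Y)
    (σ : G ≃* H) {g f : G} :
    closedSupport Y (σ g) ⊆ closedSupport Y (σ f) ↔ closedSupport X g ⊆ closedSupport X f :=
  ⟨fun h => by simpa using closedSupport_map_subset hH hG σ.symm h,
    closedSupport_map_subset hG hH σ⟩

namespace HasSupportBasis

lemma disjoint_closedSupport_map (hG : HasSupportBasis G X) (hH : HasSupportBasis H Y)
    (σ : G ≃* H) {g f : G} (h : Disjoint (closedSupport X g) (closedSupport X f)) :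
    Disjoint (closedSupport Y (σ g)) (closedSupport Y (σ f)) := by
  rw [disjoint_closedSupport_iff ‹_›] at h ⊢
  intro t
  obtain ⟨t, rfl⟩ := σ.surjective t
  simpa only [closedSupport_map_subset_iff hG.locallyMoving hH.locallyMoving,
    EmbeddingLike.map_eq_one_iff] using h t

variable (hG : HasSupportBasis G X) (hH : HasSupportBasis H Y) (σ : G ≃* H)
include hG hH

lemma corresponds_of_forall_mem {x : X} {y : Y}
    (h : ∀ g, x ∈ closedSupport X g → y ∈ closedSupport Y (σ g)) : Corresponds σ x y := by
  refine fun g => ⟨fun hy => ?_, h g⟩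
  by_contra hx
  obtain ⟨t, hxt, ht⟩ :=
    hG.exists_mem_closedSupport_subset (isClosed_closedSupport g).isOpen_compl hx
  exact Set.disjoint_left.1 (hG.disjoint_closedSupport_map hH σ
    (Set.disjoint_left.2 fun _ hz => ht hz)) (h t hxt) hy

lemma exists_corresponds [CompactSpace Y] (x : X) : ∃ y : Y, Corresponds σ x y := by
  let ι := {g : G // x ∈ closedSupport X g}
  have : Nonempty ι := by
    obtain ⟨g, hg, -⟩ := hG.exists_mem_closedSupport_subset isOpen_univ (Set.mem_univ x)
    exact ⟨g, hg⟩
  have hdir : Directed (· ⊇ ·) fun g : ι => closedSupport Y (σ g.1) := by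
    rintro ⟨f, hf⟩ ⟨g, hg⟩
    obtain ⟨t, hxt, ht⟩ := hG.exists_mem_closedSupport_subset
      ((hG.isOpen_closedSupport f).inter (hG.isOpen_closedSupport g)) ⟨hf, hg⟩
    rw [Set.subset_inter_iff] at ht
    have hmap := fun k => closedSupport_map_subset hG.locallyMoving hH.locallyMoving σ (g := t)
      (f := k)
    exact ⟨⟨t, hxt⟩, hmap _ ht.1, hmap _ ht.2⟩
  have hne : ∀ g : ι, (closedSupport Y (σ g.1)).Nonempty := fun g =>
    closedSupport_nonempty_iff.2 ((map_ne_one_iff σ σ.injective).2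
      (closedSupport_nonempty_iff.1 ⟨x, g.2⟩))
  obtain ⟨y, hy⟩ := IsCompact.nonempty_iInter_of_directed_nonempty_isCompact_isClosed _
    hdir hne (fun _ => (isClosed_closedSupport _).isCompact) fun _ => isClosed_closedSupport _
  exact ⟨y, hG.corresponds_of_forall_mem hH σ fun g hg => Set.mem_iInter.1 hy ⟨g, hg⟩⟩

theorem exists_homeomorph [CompactSpace X] [CompactSpace Y] :
    ∃ φ : X ≃ₜ Y, ∀ (g : G) (x : X), φ (g • x) = σ g • φ x := by
  choose f hf using hG.exists_corresponds hH σ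
  choose k hk using hH.exists_corresponds hG σ.symm
  let φ : X ≃ₜ Y :=
    { toFun := f
      invFun := k
      left_inv := fun x => (hk (f x)).eq hG (hf x).symm
      right_inv := fun y => (hf (k y)).eq hH (hk y).symm
      continuous_toFun := continuous_of_corresponds hG hH hf
      continuous_invFun := continuous_of_corresponds hH hG hk }
  exact ⟨φ, fun g x => (hf (g • x)).eq hH ((hf x).smul g)⟩

end HasSupportBasis

end Reconstruction

/-! ### Dyadic intervals -/

section Dyadic

variable {m w u r : List Bool} {x : Cantor}

lemma app_mem_sdi (m : List Bool) (z : Cantor) : app m z ∈ sdi m := ⟨z, rfl⟩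

lemma mem_sdi_nil (x : Cantor) : x ∈ sdi [] := ⟨x, rfl⟩

lemma sdi_append (m w : List Bool) : sdi (m ++ w) = app m '' sdi w := by
  rw [sdi, sdi, ← Set.range_comp]
  exact congrArg Set.range (funext (app_append m w))

lemma sdi_append_subset (m w : List Bool) : sdi (m ++ w) ⊆ sdi m := by
  rw [sdi_append]
  exact Set.image_subset_range _ _

lemma disjoint_sdi_cons {b c : Bool} (h : b ≠ c) (m w : List Bool) :
    Disjoint (sdi (b :: m)) (sdi (c :: w)) := by
  rw [Set.disjoint_left]
  rintro _ ⟨z, rfl⟩ ⟨y, hy⟩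
  exact h (app_cons_inj hy).1.symm

lemma disjoint_sdi_append (u : List Bool) (h : Disjoint (sdi m) (sdi w)) :
    Disjoint (sdi (u ++ m)) (sdi (u ++ w)) := by
  rw [sdi_append, sdi_append]
  exact (Set.disjoint_image_iff (app_injective u)).2 h

lemma continuous_app (m : List Bool) : Continuous (app m) := by
  induction m with
  | nil => exact continuous_id
  | cons b m ih =>
    refine continuous_pi fun n => ?_
    cases n with
    | zero => exact continuous_const
    | succ n => exact (continuous_apply n).comp ih

lemma isClopen_sdi (m : List Bool) : IsClopen (sdi m) :=
  ⟨(isCompact_range (continuous_app m)).isClosed, isOpen_sdi m⟩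

lemma app_apply_of_lt (m : List Bool) (y z : Cantor) {i : ℕ} (hi : i < m.length) :
    app m y i = app m z i := by
  induction m generalizing i with
  | nil => exact absurd hi (Nat.not_lt_zero i)
  | cons b m ih =>
    cases i with
    | zero => rfl
    | succ i => exact ih (Nat.lt_of_succ_lt_succ hi)

lemma exists_mem_sdi_subset {U : Set Cantor} (hU : IsOpen U) (hx : x ∈ U) :
    ∃ m ≠ [], x ∈ sdi m ∧ sdi m ⊆ U := by
  obtain ⟨_, ⟨y, n, rfl⟩, hxy, hs⟩ :=
    (PiNat.isTopologicalBasis_cylinders fun _ : ℕ => Bool).exists_subset_of_mem_open hx hU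
  obtain ⟨m, hm, z, rfl⟩ := exists_word (n + 1) x
  refine ⟨m, List.ne_nil_of_length_eq_add_one hm, app_mem_sdi m z, ?_⟩
  rintro _ ⟨y', rfl⟩
  exact hs fun i hi => (app_apply_of_lt m y' z (by lia)).trans (hxy i hi)

lemma exists_append_sdi_subset {U : Set Cantor} (hU : IsOpen U) (hx : x ∈ U) (hxm : x ∈ sdi m) :
    ∃ r, x ∈ sdi (m ++ r) ∧ sdi (m ++ r) ⊆ U := by
  obtain ⟨z, rfl⟩ := hxm
  obtain ⟨r, -, hz, hr⟩ := exists_mem_sdi_subset (hU.preimage (continuous_app m)) hx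
  rw [← Set.image_subset_iff, ← sdi_append] at hr
  exact ⟨r, sdi_append m r ▸ Set.mem_image_of_mem _ hz, hr⟩

end Dyadic

/-! ### The action of Thompson's group on the Cantor space -/

instance : MulAction thompsonV Cantor where
  smul v x := v.1 x
  one_smul _ := rfl
  mul_smul _ _ _ := rfl

instance : ContinuousConstSMul thompsonV Cantor := ⟨fun v => v.1.continuous⟩

instance : FaithfulSMul thompsonV Cantor := ⟨fun h => Subtype.ext (Homeomorph.ext h)⟩

section Adapted

variable {m w u : List Bool} {v f : Cantor ≃ₜ Cantor}

lemma Adapted.append (h : Adapted v m w) (r : List Bool) : Adapted v (m ++ r) (w ++ r) :=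
  fun z => by rw [app_append, app_append, h]

lemma Adapted.mul (hf : Adapted f u w) (hv : Adapted v m u) : Adapted (f * v) m w :=
  fun z => (congrArg f (hv z)).trans (hf z)

lemma Adapted.pow {r : List Bool} (h : Adapted v m (m ++ r)) (n : ℕ) :
    Adapted (v ^ n) m (m ++ (List.replicate n r).flatten) := by
  induction n with
  | zero => exact fun z => by rw [pow_zero, List.replicate_zero, List.flatten_nil, List.append_nil,
      Homeomorph.one_apply]
  | succ n ih =>
    rw [pow_succ', List.replicate_succ, List.flatten_cons, ← List.append_assoc]
    exact (h.append _).mul ih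

lemma Adapted.smul_mem_sdi_iff {v : thompsonV} (h : Adapted v.1 m w) {x : Cantor} :
    v • x ∈ sdi w ↔ x ∈ sdi m :=
  ⟨fun ⟨z, hz⟩ => ⟨z, v.1.injective ((h z).trans hz)⟩, fun ⟨z, hz⟩ => ⟨z, hz ▸ (h z).symm⟩⟩

lemma adapted_one : Adapted 1 m w ↔ m = w :=
  ⟨eq_of_app_eq, fun h _ => h ▸ rfl⟩

end Adapted

/-! ### Exchanging two dyadic intervals -/

/-- The sequence obtained from `x` by deleting the first `n` letters. -/
def drop (n : ℕ) (x : Cantor) : Cantor := fun k => x (n + k)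

lemma drop_app (m : List Bool) (z : Cantor) : drop m.length (app m z) = z := by
  induction m with
  | nil => exact funext fun k => congrArg z (Nat.zero_add k)
  | cons b m ih =>
    refine funext fun k => Eq.trans ?_ (congrFun ih k)
    simp only [drop, List.length_cons, Nat.succ_add_eq_add_succ]
    rfl

lemma continuous_drop (n : ℕ) : Continuous (drop n) :=
  continuous_pi fun k => continuous_apply (n + k)

lemma continuous_of_level {f : Cantor → Cantor} (N : ℕ)
    (h : ∀ m : List Bool, m.length = N → ∃ w, ∀ z, f (app m z) = app w z) : Continuous f := by
  rw [continuous_iff_continuousAt]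
  intro x
  obtain ⟨m, hm, z, rfl⟩ := exists_word N x
  obtain ⟨w, hw⟩ := h m hm
  have hf : f =ᶠ[𝓝 (app m z)] app w ∘ drop m.length := by
    filter_upwards [(isOpen_sdi m).mem_nhds (app_mem_sdi m z)]
    rintro _ ⟨y, rfl⟩
    rw [hw, Function.comp_apply, drop_app]
  exact ((continuous_app w).comp (continuous_drop _)).continuousAt.congr hf.symm

open Classical in
/-- Exchange the prefixes `m` and `w`, and fix the points having neither as a prefix. -/
noncomputable def swapFun (m w : List Bool) (x : Cantor) : Cantor :=
  if x ∈ sdi m then app w (drop m.length x)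
  else if x ∈ sdi w then app m (drop w.length x) else x

section Swap

variable {m w : List Bool}

lemma swapFun_left (z : Cantor) : swapFun m w (app m z) = app w z := by
  rw [swapFun, if_pos (app_mem_sdi m z), drop_app]

lemma swapFun_right (h : Disjoint (sdi m) (sdi w)) (z : Cantor) :
    swapFun m w (app w z) = app m z := by
  rw [swapFun, if_neg (Set.disjoint_right.1 h (app_mem_sdi w z)), if_pos (app_mem_sdi w z),
    drop_app]

lemma swapFun_of_notMem {x : Cantor} (hm : x ∉ sdi m) (hw : x ∉ sdi w) :
    swapFun m w x = x := by
  rw [swapFun, if_neg hm, if_neg hw]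

lemma swapFun_involutive (h : Disjoint (sdi m) (sdi w)) :
    Function.Involutive (swapFun m w) := by
  intro x
  by_cases hm : x ∈ sdi m
  · obtain ⟨z, rfl⟩ := hm
    rw [swapFun_left, swapFun_right h]
  by_cases hw : x ∈ sdi w
  · obtain ⟨z, rfl⟩ := hw
    rw [swapFun_right h, swapFun_left]
  rw [swapFun_of_notMem hm hw, swapFun_of_notMem hm hw]

lemma swapFun_level (h : Disjoint (sdi m) (sdi w)) (u : List Bool)
    (hu : u.length = m.length + w.length) : ∃ t, ∀ z, swapFun m w (app u z) = app t z := by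
  by_cases hm : ∃ z, app u z ∈ sdi m
  · obtain ⟨z, y, hy⟩ := hm
    obtain ⟨r, rfl, -⟩ := prefix_of_app_eq hy (by lia)
    exact ⟨w ++ r, fun z => by rw [app_append, app_append, swapFun_left]⟩
  by_cases hw : ∃ z, app u z ∈ sdi w
  · obtain ⟨z, y, hy⟩ := hw
    obtain ⟨r, rfl, -⟩ := prefix_of_app_eq hy (by lia)
    exact ⟨m ++ r, fun z => by rw [app_append, app_append, swapFun_right h]⟩
  push Not at hm hw
  exact ⟨u, fun z => swapFun_of_notMem (hm z) (hw z)⟩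

/-- The element of Thompson's group exchanging two disjoint dyadic intervals. -/
noncomputable def swap (h : Disjoint (sdi m) (sdi w)) : thompsonV :=
  ⟨{ toEquiv := (swapFun_involutive h).toPerm
     continuous_toFun := continuous_of_level _ (swapFun_level h)
     continuous_invFun := continuous_of_level _ (swapFun_level h) },
    isThompson_of_level _ (swapFun_level h)⟩

lemma adapted_swap_left (h : Disjoint (sdi m) (sdi w)) : Adapted (swap h).1 m w :=
  swapFun_left

lemma adapted_swap_right (h : Disjoint (sdi m) (sdi w)) : Adapted (swap h).1 w m :=
  swapFun_right h

lemma swap_mem_rigidStabilizer (h : Disjoint (sdi m) (sdi w)) :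
    swap h ∈ rigidStabilizer thompsonV (sdi m ∪ sdi w) :=
  mem_rigidStabilizer.2 fun _ hx =>
    swapFun_of_notMem (fun hm => hx (Or.inl hm)) fun hw => hx (Or.inr hw)

lemma swap_append_mem_rigidStabilizer {u : List Bool} (h : Disjoint (sdi (u ++ m)) (sdi (u ++ w))) :
    swap h ∈ rigidStabilizer thompsonV (sdi u) :=
  rigidStabilizer_mono (Set.union_subset (sdi_append_subset u m) (sdi_append_subset u w))
    (swap_mem_rigidStabilizer h)

end Swap

lemma exists_dilation (m : List Bool) (b : Bool) :
    ∃ v ∈ rigidStabilizer thompsonV (sdi m), Adapted v.1 (m ++ [b]) (m ++ [b] ++ [b]) := by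
  rw [List.append_assoc]
  have hb : b ≠ !b := (Bool.not_ne_self b).symm
  have h₁ : Disjoint (sdi (m ++ [b])) (sdi (m ++ [!b])) :=
    disjoint_sdi_append m (disjoint_sdi_cons hb [] [])
  have h₂ : Disjoint (sdi (m ++ [!b])) (sdi (m ++ [b, b])) :=
    disjoint_sdi_append m (disjoint_sdi_cons hb.symm [] [b])
  exact ⟨swap h₂ * swap h₁,
    mul_mem (swap_append_mem_rigidStabilizer h₂) (swap_append_mem_rigidStabilizer h₁),
    (adapted_swap_left h₂).mul (adapted_swap_left h₁)⟩

/-! ### Transitivity and supports -/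

section Transitivity

variable {m w : List Bool} {v : thompsonV} {x : Cantor}

lemma notMem_closedSupport_mul {f : thompsonV} (hf : x ∉ closedSupport Cantor f)
    (hv : x ∉ closedSupport Cantor v) : x ∉ closedSupport Cantor (f * v) := by
  rw [notMem_closedSupport_iff] at hf hv ⊢
  filter_upwards [hf, hv] with y hfy hvy
  rw [mul_smul, hvy, hfy]

lemma notMem_closedSupport_swap (h : Disjoint (sdi m) (sdi w)) (hm : x ∉ sdi m)
    (hw : x ∉ sdi w) : x ∉ closedSupport Cantor (swap h) := fun hx =>
  ((closedSupport_subset_iff ((isClopen_sdi m).1.union (isClopen_sdi w).1)).2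
    (swap_mem_rigidStabilizer h) hx).elim hm hw

lemma exists_disjoint_sdi_notMem (b : Bool) (x : Cantor) :
    ∃ u ≠ [], x ∉ sdi u ∧ ∀ m, Disjoint (sdi (b :: m)) (sdi u) := by
  refine ⟨[!b, !x 1], List.cons_ne_nil _ _, ?_, fun m =>
    disjoint_sdi_cons (Bool.not_ne_self b).symm m _⟩
  rintro ⟨z, hz⟩
  exact Bool.not_ne_self (x 1) (congrFun hz 1)

lemma exists_adapted_of_ne_nil (hm : m ≠ []) (hw : w ≠ []) (x : Cantor) :
    ∃ v : thompsonV, Adapted v.1 m w ∧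
      (x ∉ sdi m → x ∉ sdi w → x ∉ closedSupport Cantor v) := by
  obtain ⟨b, m, rfl⟩ := List.exists_cons_of_ne_nil hm
  obtain ⟨c, w, rfl⟩ := List.exists_cons_of_ne_nil hw
  obtain rfl | hbc := eq_or_ne b c
  · obtain ⟨u, -, hxu, hu⟩ := exists_disjoint_sdi_notMem b x
    exact ⟨swap (hu w).symm * swap (hu m),
      (adapted_swap_left (hu w).symm).mul (adapted_swap_left (hu m)), fun hxm hxw =>
        notMem_closedSupport_mul (notMem_closedSupport_swap _ hxu hxw)
          (notMem_closedSupport_swap _ hxm hxu)⟩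
  · have h := disjoint_sdi_cons hbc m w
    exact ⟨swap h, adapted_swap_left h, notMem_closedSupport_swap h⟩

lemma closure_orbit_stabilizer (p x : Cantor) (hx : x ≠ p) :
    {p}ᶜ ⊆ closure (orbit (stabilizer thompsonV p) x) := by
  intro y hy
  rw [mem_closure_iff]
  intro U hU hyU
  obtain ⟨m, hm, hxm, hmp⟩ := exists_mem_sdi_subset isOpen_compl_singleton hx
  obtain ⟨w, hw, -, hwU⟩ := exists_mem_sdi_subset (hU.inter isOpen_compl_singleton) ⟨hyU, hy⟩
  obtain ⟨v, hv, hp⟩ := exists_adapted_of_ne_nil hm hw p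
  have hvp : v • p = p := (notMem_closedSupport_iff.1
    (hp (fun h => hmp h rfl) fun h => (hwU h).2 rfl)).self_of_nhds
  exact ⟨v • x, (hwU (hv.smul_mem_sdi_iff.2 hxm)).1, ⟨⟨v, hvp⟩, rfl⟩⟩

lemma notMem_closedSupport_iff_of_adapted (hx : x ∈ sdi m) (hv : Adapted v.1 m w) :
    x ∉ closedSupport Cantor v ↔ m = w := by
  rw [notMem_closedSupport_iff]
  constructor
  · intro h
    obtain ⟨U, hU, hUo, hxU⟩ := eventually_nhds_iff.1 h
    obtain ⟨r, -, hr⟩ := exists_append_sdi_subset hUo hxU hx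
    exact List.append_cancel_right (eq_of_app_eq fun z =>
      (hU _ (hr (app_mem_sdi _ z))).symm.trans (hv.append r z))
  · rintro rfl
    filter_upwards [(isOpen_sdi m).mem_nhds hx]
    rintro _ ⟨z, rfl⟩
    exact hv z

lemma isOpen_closedSupport (v : thompsonV) : IsOpen (closedSupport Cantor v) := by
  rw [isOpen_iff_mem_nhds]
  intro x hx
  obtain ⟨⟨m, w⟩, hxm, hv⟩ := exists_adapted v x
  filter_upwards [(isOpen_sdi m).mem_nhds hxm] with y hy
  rw [← not_not (a := y ∈ _), notMem_closedSupport_iff_of_adapted hy hv,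
    ← notMem_closedSupport_iff_of_adapted hxm hv, not_not]
  exact hx

lemma exists_closedSupport_eq_sdi (m : List Bool) :
    ∃ v : thompsonV, closedSupport Cantor v = sdi m := by
  have h : Disjoint (sdi (m ++ [false])) (sdi (m ++ [true])) :=
    disjoint_sdi_append m (disjoint_sdi_cons Bool.false_ne_true [] [])
  refine ⟨swap h, ((closedSupport_subset_iff (isClopen_sdi m).1).2
    (swap_append_mem_rigidStabilizer h)).antisymm ?_⟩
  rintro _ ⟨z, rfl⟩
  obtain ⟨r, hr, z, rfl⟩ := exists_word 1 z
  obtain ⟨b, rfl⟩ := List.length_eq_one_iff.1 hr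
  have hb : Adapted (swap h).1 (m ++ [b]) (m ++ [!b]) := by
    cases b
    exacts [adapted_swap_left h, adapted_swap_right h]
  rw [← app_append, ← not_not (a := _ ∈ _),
    notMem_closedSupport_iff_of_adapted (app_mem_sdi _ z) hb]
  simp

theorem locallyMoving_thompsonV : LocallyMoving thompsonV Cantor := by
  rintro U hU ⟨x, hx⟩
  obtain ⟨m, -, -, hm⟩ := exists_mem_sdi_subset hU hx
  obtain ⟨v, hv, hvm⟩ := exists_dilation m false
  refine ⟨v, rigidStabilizer_mono hm hv, fun h => ?_⟩
  have h12 := hvm.pow 12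
  rw [← Subgroup.coe_pow, h, Subgroup.coe_one, adapted_one] at h12
  exact absurd (List.self_eq_append_right.1 h12) (by decide)

theorem hasSupportBasis_thompsonV : HasSupportBasis thompsonV Cantor where
  locallyMoving := locallyMoving_thompsonV
  isTopologicalBasis := TopologicalSpace.isTopologicalBasis_of_isOpen_of_nhds
    (Set.forall_mem_range.2 isOpen_closedSupport) fun x U hx hU => by
      obtain ⟨m, -, hxm, hm⟩ := exists_mem_sdi_subset hU hx
      obtain ⟨v, hv⟩ := exists_closedSupport_eq_sdi m
      exact ⟨_, ⟨v, rfl⟩, hv ▸ hxm, hv ▸ hm⟩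

end Transitivity

/-! ### Dyadic induction -/

lemma sdi_append_union (m : List Bool) : sdi (m ++ [false]) ∪ sdi (m ++ [true]) = sdi m := by
  refine (Set.union_subset (sdi_append_subset m _) (sdi_append_subset m _)).antisymm ?_
  rintro _ ⟨z, rfl⟩
  obtain ⟨r, hr, z, rfl⟩ := exists_word 1 z
  obtain ⟨b, rfl⟩ := List.length_eq_one_iff.1 hr
  rw [← app_append]
  cases b
  exacts [Or.inl (app_mem_sdi _ z), Or.inr (app_mem_sdi _ z)]

lemma disjoint_sdi_append_false_true (m : List Bool) :
    Disjoint (sdi (m ++ [false])) (sdi (m ++ [true])) :=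
  disjoint_sdi_append m (disjoint_sdi_cons Bool.false_ne_true [] [])

lemma dyadic_induction {P : List Bool → Prop} (h : ∀ x, ∃ w, x ∈ sdi w ∧ ∀ r, P (w ++ r))
    (hsplit : ∀ m, P (m ++ [false]) → P (m ++ [true]) → P m) : P [] := by
  choose w hw hP using h
  obtain ⟨t, -, ht⟩ := isCompact_univ.elim_nhds_subcover (fun x => sdi (w x))
    fun x _ => (isOpen_sdi (w x)).mem_nhds (hw x)
  have hlong : ∀ m : List Bool, t.sup (fun x => (w x).length) ≤ m.length → P m := by
    intro m hm
    obtain ⟨x, hx, z, hz⟩ := Set.mem_iUnion₂.1 (ht (Set.mem_univ (app m fun _ => true)))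
    obtain ⟨r, rfl, -⟩ :=
      prefix_of_app_eq hz ((Finset.le_sup (f := fun x => (w x).length) hx).trans hm)
    exact hP x r
  have key : ∀ (n : ℕ) (m : List Bool),
      t.sup (fun x => (w x).length) ≤ m.length + n → P m := by
    intro n
    induction n with
    | zero => exact hlong
    | succ n ih =>
      refine fun m hm => hsplit m (ih _ ?_) (ih _ ?_) <;>
      simpa only [List.length_append, List.length_singleton, add_assoc, add_comm 1 n] using hm
  exact key _ [] le_add_self

/-! ### Loops supported in a subset of the Cantor space -/

lemma ext_smul {Y : Type*} {a b : LocallyConstant Cantor Y} (v : thompsonV)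
    (h : ∀ x, a (v • x) = b (v • x)) : a = b :=
  LocallyConstant.ext ((MulAction.surjective v).forall.2 h)

section Loops

variable {Γ : Type*} [Group Γ]

variable (Γ) in
/-- The loops that are trivial outside of `S`. -/
def loopsOn (S : Set Cantor) : Subgroup (LoopGroup Γ) where
  carrier := {a | ∀ y ∉ S, a y = 1}
  one_mem' _ _ := rfl
  mul_mem' ha hb y hy := by rw [LocallyConstant.mul_apply, ha y hy, hb y hy, mul_one]
  inv_mem' ha y hy := by rw [LocallyConstant.inv_apply, ha y hy, inv_one]

variable {S S' : Set Cantor} {a b : LoopGroup Γ}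

instance : (loopsOn Γ S).Normal where
  conj_mem a ha g y hy := by
    rw [LocallyConstant.mul_apply, LocallyConstant.mul_apply, ha y hy, mul_one,
      LocallyConstant.inv_apply, mul_inv_cancel]

lemma commute_of_mem_loopsOn (h : Disjoint S S') (ha : a ∈ loopsOn Γ S)
    (hb : b ∈ loopsOn Γ S') : Commute a b := by
  ext y
  rw [LocallyConstant.mul_apply, LocallyConstant.mul_apply]
  by_cases hy : y ∈ S
  · rw [hb y (Set.disjoint_left.1 h hy), mul_one, one_mul]
  · rw [ha y hy, mul_one, one_mul]

lemma mulIndicator_mem_loopsOn (a : LoopGroup Γ) (hS : IsClopen S) :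
    a.mulIndicator hS ∈ loopsOn Γ S :=
  fun _ hy => LocallyConstant.mulIndicator_of_notMem a hS hy

lemma mulIndicator_mul_mulIndicator_compl (a : LoopGroup Γ) (hS : IsClopen S) :
    a.mulIndicator hS * a.mulIndicator hS.compl = a :=
  DFunLike.coe_injective (Set.mulIndicator_self_mul_compl S a)

lemma mulIndicator_sdi_nil (a : LoopGroup Γ) : a.mulIndicator (isClopen_sdi []) = a :=
  LocallyConstant.ext fun x => LocallyConstant.mulIndicator_of_mem a _ (mem_sdi_nil x)

lemma mulIndicator_sdi (a : LoopGroup Γ) (m : List Bool) :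
    a.mulIndicator (isClopen_sdi m) =
      a.mulIndicator (isClopen_sdi (m ++ [false])) *
        a.mulIndicator (isClopen_sdi (m ++ [true])) := by
  refine DFunLike.coe_injective ?_
  change Set.mulIndicator (sdi m) a = _
  rw [← sdi_append_union, Set.mulIndicator_union_of_disjoint (disjoint_sdi_append_false_true m)]
  rfl

variable (α₀ α₁ : MulAut Γ) {m w : List Bool} {v : thompsonV} {x : Cantor}

lemma jonesAction_apply (v : thompsonV) (a : LoopGroup Γ) (x : Cantor) :
    jonesAction α₀ α₁ v a (v • x) = tau α₀ α₁ v x (a x) := act_apply α₀ α₁ v a x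

lemma jonesAction_mem_loopsOn (h : Adapted v.1 m w) (ha : a ∈ loopsOn Γ (sdi m)) :
    jonesAction α₀ α₁ v a ∈ loopsOn Γ (sdi w) := by
  intro y hy
  obtain ⟨y, rfl⟩ := MulAction.surjective v y
  rw [jonesAction_apply, ha y fun h' => hy (h.smul_mem_sdi_iff.2 h'), map_one]

lemma tau_eq_one_of_notMem (h : x ∉ closedSupport Cantor v) : tau α₀ α₁ v x = 1 := by
  obtain ⟨⟨m, w⟩, hx, hv⟩ := exists_adapted v x
  rw [tau_eq α₀ α₁ v hx hv, (notMem_closedSupport_iff_of_adapted hx hv).1 h, inv_mul_cancel]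

lemma wordAut_append_singleton (m : List Bool) (b : Bool) :
    wordAut α₀ α₁ (m ++ [b]) = (bif b then α₁ else α₀) * wordAut α₀ α₁ m := by
  rw [wordAut_append, wordAut, wordAut, one_mul]

/-- The loop with value `α_m⁻¹ k` on the sequences with prefix `m`, trivial elsewhere. The
normalization by `α_m` makes `V` permute these loops; `bump [] k` is the constant loop `k`. -/
noncomputable def bump (m : List Bool) : Γ →* LoopGroup Γ where
  toFun k := (LocallyConstant.const Cantor ((wordAut α₀ α₁ m)⁻¹ k)).mulIndicator (isClopen_sdi m)
  map_one' := by
    rw [map_one]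
    exact DFunLike.coe_injective (Set.mulIndicator_one Γ (sdi m))
  map_mul' k l := by
    rw [map_mul]
    exact DFunLike.coe_injective (Set.mulIndicator_mul (sdi m) _ _)

lemma bump_apply (m : List Bool) (k : Γ) :
    bump α₀ α₁ m k =
      (LocallyConstant.const Cantor ((wordAut α₀ α₁ m)⁻¹ k)).mulIndicator (isClopen_sdi m) :=
  rfl

lemma bump_of_mem (k : Γ) (hx : x ∈ sdi m) : bump α₀ α₁ m k x = (wordAut α₀ α₁ m)⁻¹ k :=
  LocallyConstant.mulIndicator_of_mem _ (isClopen_sdi m) hx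

lemma bump_mem_loopsOn (m : List Bool) (k : Γ) : bump α₀ α₁ m k ∈ loopsOn Γ (sdi m) :=
  mulIndicator_mem_loopsOn _ (isClopen_sdi m)

lemma bump_split (m : List Bool) (k : Γ) :
    bump α₀ α₁ m k = bump α₀ α₁ (m ++ [false]) (α₀ k) * bump α₀ α₁ (m ++ [true]) (α₁ k) := by
  simp only [bump_apply, wordAut_append_singleton, mul_inv_rev, cond_false, cond_true,
    MulAut.mul_apply, MulAut.inv_apply_self]
  exact mulIndicator_sdi _ m

lemma jonesAction_bump (h : Adapted v.1 m w) (k : Γ) :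
    jonesAction α₀ α₁ v (bump α₀ α₁ m k) = bump α₀ α₁ w k := by
  refine ext_smul v fun x => ?_
  by_cases hx : x ∈ sdi m
  · rw [jonesAction_apply, bump_of_mem α₀ α₁ k hx, bump_of_mem α₀ α₁ k (h.smul_mem_sdi_iff.2 hx),
      tau_eq α₀ α₁ v hx h, MulAut.mul_apply, MulAut.apply_inv_self]
  · have hvx : v • x ∉ sdi w := h.smul_mem_sdi_iff.not.2 hx
    rw [jonesAction_mem_loopsOn α₀ α₁ h (bump_mem_loopsOn α₀ α₁ m k) _ hvx,
      bump_mem_loopsOn α₀ α₁ w k _ hvx]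

variable {α₀ α₁}

lemma wordAut_apply_eq_of_fixed (ha : ∀ v, jonesAction α₀ α₁ v a = a) (h : Adapted v.1 m w)
    (hx : x ∈ sdi m) : wordAut α₀ α₁ w (a (v • x)) = wordAut α₀ α₁ m (a x) := by
  conv_lhs => rw [← ha v]
  rw [jonesAction_apply, tau_eq α₀ α₁ v hx h, MulAut.mul_apply, MulAut.apply_inv_self]

lemma exists_eq_bump_nil_of_fixed (ha : ∀ v, jonesAction α₀ α₁ v a = a) :
    ∃ k, a = bump α₀ α₁ [] k ∧ α₀ k = k ∧ α₁ k = k := by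
  let x : Cantor := fun _ => true
  obtain ⟨U, hU, hxU, haU⟩ := a.isLocallyConstant.exists_open x
  obtain ⟨m, hm, -, hmU⟩ := exists_mem_sdi_subset hU hxU
  have hword : ∀ w ≠ [], ∀ y ∈ sdi w, wordAut α₀ α₁ w (a y) = wordAut α₀ α₁ m (a x) := by
    intro w hw
    obtain ⟨v, hv, -⟩ := exists_adapted_of_ne_nil hm hw x
    refine (MulAction.surjective v).forall.2 fun y hy => ?_
    have hym := hv.smul_mem_sdi_iff.1 hy
    exact (wordAut_apply_eq_of_fixed ha hv hym).trans (congrArg _ (haU y (hmU hym)))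
  have hfix : ∀ b, (bif b then α₁ else α₀) (wordAut α₀ α₁ m (a x)) = wordAut α₀ α₁ m (a x) := by
    intro b
    have hy := hmU (sdi_append_subset m [b] (app_mem_sdi _ x))
    have h := hword (m ++ [b]) (by simp) _ (app_mem_sdi _ x)
    rwa [show a _ = a x from haU _ hy, wordAut_append_singleton] at h
  refine ⟨_, LocallyConstant.ext fun y => ?_, hfix false, hfix true⟩
  obtain ⟨w, hw, z, rfl⟩ := exists_word 1 y
  obtain ⟨b, rfl⟩ := List.length_eq_one_iff.1 hw
  rw [bump_of_mem α₀ α₁ _ (mem_sdi_nil _)]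
  refine (wordAut α₀ α₁ [b]).injective ((hword [b] (by simp) _ (app_mem_sdi _ z)).trans ?_)
  exact (hfix b).symm

end Loops

/-! ### Equivariant isomorphisms of loop groups -/

/-- An isomorphism of loop groups that intertwines the action of `V` on `LΓ` with an action of
`V` on `LΔ` which, at each point `x`, moves the values from `x` to `v x` by the automorphism
`twist v x`; the latter is inner at the points near which `v` is trivial. -/
structure LoopIso {Γ : Type*} [Group Γ] (α₀ α₁ : MulAut Γ) (Δ : Type*) [Group Δ] where
  /-- the isomorphism -/
  iso : LoopGroup Γ ≃* LoopGroup Δ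
  /-- the automorphism by which `v` transports values from `x` to `v x` -/
  twist : thompsonV → Cantor → MulAut Δ
  equivariant : ∀ v a x, iso (jonesAction α₀ α₁ v a) (v • x) = twist v x (iso a x)
  isInner : ∀ v x, x ∉ closedSupport Cantor v → IsInner (twist v x)

namespace LoopIso

variable {Γ Δ : Type*} [Group Γ] [Group Δ] {α₀ α₁ : MulAut Γ} (T : LoopIso α₀ α₁ Δ)

/-- The value at `x` of the image of a loop under `T`. -/
def evalAt (x : Cantor) : LoopGroup Γ →* Δ := (LocallyConstant.evalMonoidHom x).comp T.iso

lemma evalAt_jonesAction (v : thompsonV) (a : LoopGroup Γ) (x : Cantor) :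
    T.evalAt (v • x) (jonesAction α₀ α₁ v a) = T.twist v x (T.evalAt x a) :=
  T.equivariant v a x

lemma evalAt_surjective (x : Cantor) : Function.Surjective (T.evalAt x) := fun d =>
  ⟨T.iso.symm (LocallyConstant.const Cantor d),
    congrArg (fun a : LoopGroup Δ => a x) (T.iso.apply_symm_apply _)⟩

lemma eq_of_evalAt_eq {a b : LoopGroup Γ} (h : ∀ x, T.evalAt x a = T.evalAt x b) : a = b :=
  T.iso.injective (LocallyConstant.ext h)

lemma isLocallyConstant_evalAt (a : LoopGroup Γ) : IsLocallyConstant fun x => T.evalAt x a :=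
  (T.iso a).isLocallyConstant

variable {m : List Bool} {x : Cantor}

lemma exists_evalAt_eq_conj {v : thompsonV} (hv : x ∉ closedSupport Cantor v) :
    ∃ e, ∀ a, T.evalAt x (jonesAction α₀ α₁ v a) = T.evalAt x (e * a * e⁻¹) := by
  obtain ⟨d, hd⟩ := T.isInner v x hv
  obtain ⟨e, rfl⟩ := T.evalAt_surjective x d
  have hvx : v • x = x := (notMem_closedSupport_iff.1 hv).self_of_nhds
  refine ⟨e, fun a => ?_⟩
  conv_lhs => rw [← hvx]
  rw [evalAt_jonesAction, hd, MulAut.conj_apply, map_mul, map_mul, map_inv]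

lemma ne_nil_of_notMem_sdi (hx : x ∉ sdi m) : m ≠ [] := fun h => hx (h ▸ mem_sdi_nil x)

lemma notMem_sdi_not (x : Cantor) (m : List Bool) : x ∉ sdi ((!x 0) :: m) := fun ⟨_, hz⟩ =>
  Bool.not_ne_self (x 0) (congrFun hz 0)

-- Any loop is a product of one supported in `sdi m` and one supported off it. The latter commutes
-- with `a`; the former commutes with a translate of `a` having the same value at `x`.
lemma commute_evalAt {a : LoopGroup Γ} (ha : a ∈ loopsOn Γ (sdi m)) (hx : x ∉ sdi m) (d : Δ) :
    Commute (T.evalAt x a) d := by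
  have hm := ne_nil_of_notMem_sdi hx
  obtain ⟨c, m, rfl⟩ := List.exists_cons_of_ne_nil hm
  obtain ⟨u, hu, hxu, hd⟩ := exists_disjoint_sdi_notMem c x
  obtain ⟨v, hv, hvx⟩ := exists_adapted_of_ne_nil hm hu x
  obtain ⟨e, he⟩ := T.exists_evalAt_eq_conj (hvx hx hxu)
  obtain ⟨q, rfl⟩ := T.evalAt_surjective x d
  let a' := e⁻¹ * jonesAction α₀ α₁ v a * e
  have ha' : a' ∈ loopsOn Γ (sdi u) :=
    Subgroup.Normal.conj_mem' inferInstance _ (jonesAction_mem_loopsOn α₀ α₁ hv ha) e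
  have hax : T.evalAt x a' = T.evalAt x a := by
    simp only [a', map_mul, he, map_inv]
    group
  have hc := isClopen_sdi (c :: m)
  rw [← mulIndicator_mul_mulIndicator_compl q hc, map_mul]
  refine Commute.mul_right (hax ▸ ?_) ?_
  · exact (commute_of_mem_loopsOn (hd m).symm ha' (mulIndicator_mem_loopsOn q hc)).map _
  · exact (commute_of_mem_loopsOn disjoint_compl_right ha
      (mulIndicator_mem_loopsOn q hc.compl)).map _

/-- The value at `x` of the image of a loop supported on an interval not containing `x`; by
`evalAt_bump_of_notMem` this does not depend on the interval. -/
noncomputable def outer (x : Cantor) : Γ →* Δ := (T.evalAt x).comp (bump α₀ α₁ [!x 0])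

lemma commute_outer (x : Cantor) (k : Γ) (d : Δ) : Commute (T.outer x k) d :=
  T.commute_evalAt (bump_mem_loopsOn α₀ α₁ _ k) (notMem_sdi_not x []) d

lemma evalAt_bump_of_notMem (hx : x ∉ sdi m) (k : Γ) :
    T.evalAt x (bump α₀ α₁ m k) = T.outer x k := by
  obtain ⟨v, hv, hvx⟩ := exists_adapted_of_ne_nil (ne_nil_of_notMem_sdi hx)
    (List.cons_ne_nil (!x 0) []) x
  obtain ⟨e, he⟩ := T.exists_evalAt_eq_conj (hvx hx (notMem_sdi_not x []))
  have h := he (bump α₀ α₁ m k)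
  rw [jonesAction_bump α₀ α₁ hv, map_mul, map_mul, map_inv,
    ← (T.commute_evalAt (bump_mem_loopsOn α₀ α₁ m k) hx (T.evalAt x e)).eq,
    mul_inv_cancel_right] at h
  exact h.symm

lemma outer_split (x : Cantor) (k : Γ) :
    T.outer x k = T.outer x (α₀ k) * T.outer x (α₁ k) := by
  have h := congrArg (T.evalAt x) (bump_split α₀ α₁ [!x 0] k)
  have hx (b : Bool) : x ∉ sdi ([!x 0] ++ [b]) := notMem_sdi_not x [b]
  rwa [map_mul, T.evalAt_bump_of_notMem (hx false), T.evalAt_bump_of_notMem (hx true)] at h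

lemma outer_smul (v : thompsonV) (x : Cantor) (k : Γ) :
    T.outer (v • x) k = T.twist v x (T.outer x k) := by
  obtain ⟨⟨m, w⟩, ⟨z, hz⟩, hv⟩ := exists_adapted v fun _ => !x 0
  obtain ⟨r, -, hr⟩ := exists_append_sdi_subset (isOpen_sdi [!x 0])
    ⟨fun _ => !x 0, funext fun n => by cases n <;> rfl⟩ ⟨z, hz⟩
  have hx : x ∉ sdi (m ++ r) := fun h => notMem_sdi_not x [] (hr h)
  have hvr := hv.append r
  rw [← T.evalAt_bump_of_notMem hx, ← evalAt_jonesAction, jonesAction_bump α₀ α₁ hvr,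
    T.evalAt_bump_of_notMem (hvr.smul_mem_sdi_iff.not.2 hx)]

lemma isLocallyConstant_outer (k : Γ) : IsLocallyConstant fun x => T.outer x k := by
  rw [IsLocallyConstant.iff_eventually_eq]
  intro x
  filter_upwards [(IsLocallyConstant.iff_eventually_eq _).1
      (T.isLocallyConstant_evalAt (bump α₀ α₁ [!x 0] k)) x,
    (isClopen_sdi [!x 0]).compl.isOpen.mem_nhds (notMem_sdi_not x [])] with y hy hyx
  exact (T.evalAt_bump_of_notMem hyx k).symm.trans hy

lemma exists_evalAt_bump_nil_eq_outer (k : Γ) :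
    ∃ l, T.outer x l = 1 ∧ ∀ y, T.evalAt y (bump α₀ α₁ [] l) = T.outer y k := by
  obtain ⟨a, ha⟩ := T.iso.surjective ⟨fun y => T.outer y k, T.isLocallyConstant_outer k⟩
  have hay : ∀ y, T.evalAt y a = T.outer y k := DFunLike.congr_fun ha
  have hfix : ∀ v, jonesAction α₀ α₁ v a = a := fun v =>
    T.eq_of_evalAt_eq ((MulAction.surjective v).forall.2 fun y => by
      rw [evalAt_jonesAction, hay, hay, outer_smul])
  obtain ⟨l, rfl, h₀, h₁⟩ := exists_eq_bump_nil_of_fixed hfix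
  have hsplit := T.outer_split x l
  rw [h₀, h₁] at hsplit
  exact ⟨l, left_eq_mul.1 hsplit, hay⟩

/-- The effect of `T` at the point `x` on constant loops, corrected by the contribution of the
loops supported away from `x`. -/
noncomputable def localHom (x : Cantor) : Γ →* Δ where
  toFun g := T.evalAt x (bump α₀ α₁ [] g) * (T.outer x g)⁻¹
  map_one' := by simp only [map_one, inv_one, mul_one]
  map_mul' g h := by
    rw [map_mul, map_mul, map_mul, mul_inv_rev, ← (T.commute_outer x g _).inv_inv.eq,
      (T.commute_outer x g _).inv_left.symm.mul_mul_mul_comm]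

lemma localHom_eq (hx : x ∈ sdi m) (g : Γ) :
    T.localHom x g = T.evalAt x (bump α₀ α₁ m (wordAut α₀ α₁ m g)) *
      (T.outer x (wordAut α₀ α₁ m g))⁻¹ := by
  induction m using List.reverseRecOn with
  | nil => rfl
  | append_singleton m b ih =>
    rw [ih (sdi_append_subset _ _ hx), bump_split, outer_split, map_mul, wordAut_append_singleton]
    have hd := disjoint_sdi_append_false_true m
    cases b
    · rw [T.evalAt_bump_of_notMem (Set.disjoint_left.1 hd hx)]
      simp [mul_assoc]
    · rw [T.evalAt_bump_of_notMem (Set.disjoint_right.1 hd hx),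
        (T.commute_outer x _ (T.outer x _)).eq, (T.commute_outer x _ (T.evalAt x _)).eq]
      simp [mul_assoc]

lemma localHom_smul (v : thompsonV) (x : Cantor) (g : Γ) :
    T.localHom (v • x) (tau α₀ α₁ v x g) = T.twist v x (T.localHom x g) := by
  obtain ⟨⟨m, w⟩, hx, hv⟩ := exists_adapted v x
  have hw : wordAut α₀ α₁ w (tau α₀ α₁ v x g) = wordAut α₀ α₁ m g := by
    rw [tau_eq α₀ α₁ v hx hv, MulAut.mul_apply, MulAut.apply_inv_self]
  rw [T.localHom_eq hx, T.localHom_eq (hv.smul_mem_sdi_iff.2 hx), hw, outer_smul, map_mul,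
    map_inv, ← evalAt_jonesAction, jonesAction_bump α₀ α₁ hv]

lemma isLocallyConstant_localHom (g : Γ) : IsLocallyConstant fun x => T.localHom x g :=
  (T.isLocallyConstant_evalAt _).mul (T.isLocallyConstant_outer g).inv

lemma eq_one_of_evalAt_bump_eq_outer (hm : m ≠ []) {k : Γ}
    (h : ∀ y, T.evalAt y (bump α₀ α₁ m k) = T.outer y k) : k = 1 := by
  obtain ⟨c, m, rfl⟩ := List.exists_cons_of_ne_nil hm
  let x : Cantor := fun _ => false
  obtain ⟨l, -, hl⟩ := T.exists_evalAt_bump_nil_eq_outer (x := x) k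
  have hbump : bump α₀ α₁ (c :: m) k = bump α₀ α₁ [] l :=
    T.eq_of_evalAt_eq fun y => (h y).trans (hl y).symm
  have hl₁ : l = 1 := by
    have hx := Set.disjoint_right.1 (disjoint_sdi_cons (Bool.not_ne_self c).symm m [])
      (app_mem_sdi _ x)
    have hval := bump_mem_loopsOn α₀ α₁ (c :: m) k _ hx
    rwa [hbump, bump_of_mem α₀ α₁ l (mem_sdi_nil _), map_eq_one_iff] at hval
    exact (wordAut α₀ α₁ [])⁻¹.injective
  have hval := bump_of_mem α₀ α₁ k (app_mem_sdi (c :: m) x)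
  rw [hbump, hl₁, map_one] at hval
  exact (map_eq_one_iff _ (wordAut α₀ α₁ (c :: m))⁻¹.injective).1 hval.symm

lemma localHom_injective (x : Cantor) : Function.Injective (T.localHom x) := by
  rw [injective_iff_map_eq_one]
  intro g hg
  obtain ⟨U, hU, hxU, hgU⟩ := (T.isLocallyConstant_localHom g).exists_open x
  obtain ⟨m, hm, -, hmU⟩ := exists_mem_sdi_subset hU hxU
  refine (map_eq_one_iff _ (wordAut α₀ α₁ m).injective).1
    (T.eq_one_of_evalAt_bump_eq_outer hm fun y => ?_)
  by_cases hy : y ∈ sdi m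
  · exact mul_inv_eq_one.1 ((T.localHom_eq hy g).symm.trans ((hgU y (hmU hy)).trans hg))
  · exact T.evalAt_bump_of_notMem hy _

lemma outer_mem_range_localHom (x : Cantor) (k : Γ) : T.outer x k ∈ (T.localHom x).range := by
  obtain ⟨l, hl, hlk⟩ := T.exists_evalAt_bump_nil_eq_outer (x := x) k
  refine ⟨l, ?_⟩
  rw [T.localHom_eq (mem_sdi_nil x), wordAut, MulAut.one_apply, hl, inv_one, mul_one, hlk]

lemma evalAt_bump_mem_range_localHom (x : Cantor) (m : List Bool) (k : Γ) :
    T.evalAt x (bump α₀ α₁ m k) ∈ (T.localHom x).range := by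
  by_cases hx : x ∈ sdi m
  · have h := T.localHom_eq hx ((wordAut α₀ α₁ m)⁻¹ k)
    rw [MulAut.apply_inv_self] at h
    rw [← eq_mul_inv_iff_mul_eq.1 h]
    exact mul_mem ⟨_, rfl⟩ (T.outer_mem_range_localHom x k)
  · rw [T.evalAt_bump_of_notMem hx]
    exact T.outer_mem_range_localHom x k

lemma localHom_surjective (x : Cantor) : Function.Surjective (T.localHom x) := by
  intro d
  obtain ⟨a, rfl⟩ := T.evalAt_surjective x d
  rw [← mulIndicator_sdi_nil a]
  refine dyadic_induction (P := fun m =>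
    T.evalAt x (a.mulIndicator (isClopen_sdi m)) ∈ (T.localHom x).range)
    (fun y => ?_) fun m h h' => ?_
  · obtain ⟨U, hU, hyU, haU⟩ := a.isLocallyConstant.exists_open y
    obtain ⟨w, -, hyw, hwU⟩ := exists_mem_sdi_subset hU hyU
    refine ⟨w, hyw, fun r => ?_⟩
    have hbump : a.mulIndicator (isClopen_sdi (w ++ r)) =
        bump α₀ α₁ (w ++ r) (wordAut α₀ α₁ (w ++ r) (a y)) := by
      rw [bump_apply, MulAut.inv_apply_self]
      exact DFunLike.coe_injective (Set.mulIndicator_congr fun z hz =>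
        haU z (hwU (sdi_append_subset w r hz)))
    rw [hbump]
    exact T.evalAt_bump_mem_range_localHom x _ _
  · rw [mulIndicator_sdi, map_mul]
    exact mul_mem h h'

/-- The isomorphism `Γ ≃* Δ` induced at the point `x`. -/
noncomputable def localIso (x : Cantor) : Γ ≃* Δ :=
  MulEquiv.ofBijective (T.localHom x) ⟨T.localHom_injective x, T.localHom_surjective x⟩

lemma localIso_smul (v : thompsonV) (x : Cantor) (g : Γ) :
    T.localIso (v • x) (tau α₀ α₁ v x g) = T.twist v x (T.localIso x g) :=
  T.localHom_smul v x g

end LoopIso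

/-! ### Isomorphisms of semidirect products -/

section SemidirectProduct

variable {N₁ N₂ G₁ G₂ : Type*} [Group N₁] [Group N₂] [Group G₁] [Group G₂]
  {φ₁ : G₁ →* MulAut N₁} {φ₂ : G₂ →* MulAut N₂}

lemma inl_left_of_right_eq_one {x : N₁ ⋊[φ₁] G₁} (h : x.right = 1) : inl x.left = x :=
  SemidirectProduct.ext rfl h.symm

section Hom

variable {F : Type*} [FunLike F (N₁ ⋊[φ₁] G₁) (N₂ ⋊[φ₂] G₂)]
  [MonoidHomClass F (N₁ ⋊[φ₁] G₁) (N₂ ⋊[φ₂] G₂)] {θ : F} (hθ : ∀ n, (θ (inl n)).right = 1)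

include hθ

lemma right_map (x : N₁ ⋊[φ₁] G₁) : (θ x).right = (θ (inr x.right)).right := by
  conv_lhs => rw [← inl_left_mul_inr_right x]
  rw [map_mul, mul_right, hθ, one_mul]

lemma left_map_inl_aut (g : G₁) (n : N₁) :
    (θ (inl (φ₁ g n))).left =
      (θ (inr g)).left * φ₂ (θ (inr g)).right (θ (inl n)).left * (θ (inr g)).left⁻¹ := by
  have h : θ (inl (φ₁ g n)) * θ (inr g) = θ (inr g) * θ (inl n) := by
    rw [← map_mul, ← map_mul, inl_aut, mul_assoc, ← map_mul, inv_mul_cancel, map_one, mul_one]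
  have hleft := congrArg SemidirectProduct.left h
  rw [mul_left, mul_left, hθ, map_one, MulAut.one_apply] at hleft
  exact eq_mul_inv_of_mul_eq hleft

end Hom

variable (θ : N₁ ⋊[φ₁] G₁ ≃* N₂ ⋊[φ₂] G₂) (hθ : ∀ n, (θ (inl n)).right = 1)
  (hθ' : ∀ n, (θ.symm (inl n)).right = 1)

/-- The isomorphism of kernels induced by an isomorphism of semidirect products that
preserves them. -/
def kernelCongr : N₁ ≃* N₂ where
  toFun n := (θ (inl n)).left
  invFun n := (θ.symm (inl n)).left
  left_inv n := by
    beta_reduce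
    rw [inl_left_of_right_eq_one (hθ _), θ.symm_apply_apply]
    rfl
  right_inv n := by
    beta_reduce
    rw [inl_left_of_right_eq_one (hθ' _), θ.apply_symm_apply]
    rfl
  map_mul' n n' := by rw [map_mul, map_mul, mul_left, hθ, map_one, MulAut.one_apply]

/-- The isomorphism of quotients induced by an isomorphism of semidirect products that
preserves their kernels. -/
def quotientCongr : G₁ ≃* G₂ where
  toFun g := (θ (inr g)).right
  invFun g := (θ.symm (inr g)).right
  left_inv g := by
    beta_reduce
    rw [← right_map hθ', θ.symm_apply_apply]
    rfl
  right_inv g := by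
    beta_reduce
    rw [← right_map hθ, θ.apply_symm_apply]
    rfl
  map_mul' g h := by rw [map_mul, map_mul, mul_right]

end SemidirectProduct

/-! ### Isomorphisms of fraction groups -/

section FractionGroup

variable {Γ Δ : Type*} [Group Γ] [Group Δ] {α₀ α₁ : MulAut Γ} {β₀ β₁ : MulAut Δ}

-- The image of `LΓ` in `V` is normal, and it is generated by two commuting normal subgroups, the
-- images of the loops on the two halves of the Cantor space, which are conjugate in `V`.
lemma right_map_inl (θ : FractionGroup α₀ α₁ ≃* FractionGroup β₀ β₁) (a : LoopGroup Γ) :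
    (θ (inl a)).right = 1 := by
  let π : FractionGroup α₀ α₁ →* thompsonV := rightHom.comp θ.toMonoidHom
  let ψ : LoopGroup Γ →* thompsonV := π.comp inl
  have hψ : ψ.range.Normal := by
    rw [MonoidHom.range_comp, range_inl_eq_ker_rightHom]
    exact (MonoidHom.normal_ker _).map π (rightHom_surjective.comp θ.surjective)
  have hnorm : ψ.range ≤ Subgroup.normalizer (((loopsOn Γ (sdi [false])).map ψ : Set _)) := by
    have h := Subgroup.le_normalizer_map (H := loopsOn Γ (sdi [false])) ψ
    rwa [Subgroup.normalizer_eq_top, ← MonoidHom.range_eq_map] at h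
  have hhalf : (loopsOn Γ (sdi [false])).map ψ = ⊥ ∨ (loopsOn Γ (sdi [true])).map ψ = ⊥ := by
    refine locallyMoving_thompsonV.eq_bot_or_eq_bot_of_commute closure_orbit_stabilizer
      (Subgroup.map_le_range ψ _) hnorm ?_
    rintro _ ⟨b, hb, rfl⟩ _ ⟨c, hc, rfl⟩
    exact (commute_of_mem_loopsOn (disjoint_sdi_append_false_true []) hb hc).map ψ
  have htransport : ∀ b c, (loopsOn Γ (sdi [b])).map ψ = ⊥ → loopsOn Γ (sdi [c]) ≤ ψ.ker := by
    intro b c h f hf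
    obtain ⟨v, hv, -⟩ := exists_adapted_of_ne_nil (List.cons_ne_nil c [])
      (List.cons_ne_nil b []) fun _ => true
    have hvf : π (inl (jonesAction α₀ α₁ v f)) = 1 :=
      (Subgroup.map_eq_bot_iff _).1 h (jonesAction_mem_loopsOn α₀ α₁ hv hf)
    rwa [inl_aut, map_mul, map_mul, map_inv, map_inv, conj_eq_one_iff] at hvf
  have hker : ∀ c, loopsOn Γ (sdi [c]) ≤ ψ.ker := fun c =>
    hhalf.elim (htransport false c) (htransport true c)
  suffices h : a ∈ ψ.ker from h
  rw [← mulIndicator_sdi_nil a, mulIndicator_sdi]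
  exact mul_mem (hker false (mulIndicator_mem_loopsOn a _))
    (hker true (mulIndicator_mem_loopsOn a _))

theorem exists_loopIso (θ : FractionGroup α₀ α₁ ≃* FractionGroup β₀ β₁) :
    ∃ T : LoopIso α₀ α₁ Δ, ∀ v x, ∃ d w y, T.twist v x = MulAut.conj d * tau β₀ β₁ w y := by
  let σ := quotientCongr θ (right_map_inl θ) (right_map_inl θ.symm)
  obtain ⟨φ, hφ⟩ := hasSupportBasis_thompsonV.exists_homeomorph hasSupportBasis_thompsonV σ
  let κ := kernelCongr θ (right_map_inl θ) (right_map_inl θ.symm)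
  let C : LoopGroup Δ ≃* LoopGroup Δ :=
    { LocallyConstant.congrLeft φ.symm with map_mul' := fun _ _ => rfl }
  have hC : ∀ a x, C a x = a (φ x) := fun _ _ => rfl
  have hκ : ∀ v a, κ (jonesAction α₀ α₁ v a) =
      (θ (inr v)).left * jonesAction β₀ β₁ (σ v) (κ a) * (θ (inr v)).left⁻¹ :=
    left_map_inl_aut (right_map_inl θ)
  refine ⟨⟨κ.trans C, fun v x => MulAut.conj ((θ (inr v)).left (φ (v • x))) *
    tau β₀ β₁ (σ v) (φ x), fun v a x => ?_, fun v x hx => ?_⟩, fun v x => ⟨_, _, _, rfl⟩⟩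
  · rw [MulEquiv.trans_apply, MulEquiv.trans_apply, hC, hC, hκ, LocallyConstant.mul_apply,
      LocallyConstant.mul_apply, LocallyConstant.inv_apply, hφ, jonesAction_apply]
    rfl
  · rw [closedSupport_eq_preimage φ (hφ v)] at hx
    exact ⟨_, by rw [tau_eq_one_of_notMem β₀ β₁ hx, mul_one]⟩

end FractionGroup

/-! ### Inner automorphisms -/

section Inner

variable {Γ Δ : Type*} [Group Γ] [Group Δ] {α₀ α₁ α : MulAut Γ} {β₀ β₁ β : MulAut Δ}

lemma isInner_iff_mem_range : IsInner α ↔ α ∈ (MulAut.conj : Γ →* MulAut Γ).range :=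
  exists_congr fun _ => eq_comm

lemma isInner_one : IsInner (1 : MulAut Γ) := ⟨1, (map_one _).symm⟩

lemma IsInner.of_intertwining (hβ : IsInner β) (f : Γ ≃* Δ) (h : ∀ g, f (α g) = β (f g)) :
    IsInner α := by
  obtain ⟨d, rfl⟩ := hβ
  obtain ⟨g, rfl⟩ := f.surjective d
  refine ⟨g, MulEquiv.ext fun k => f.injective ?_⟩
  rw [h, MulAut.conj_apply, MulAut.conj_apply, map_mul, map_mul, map_inv]

lemma isInner_wordAut (h₀ : IsInner α₀) (h₁ : IsInner α₁) (m : List Bool) :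
    IsInner (wordAut α₀ α₁ m) := by
  simp only [isInner_iff_mem_range] at *
  induction m with
  | nil => exact one_mem _
  | cons b m ih => exact mul_mem ih (by cases b <;> assumption)

lemma isInner_tau (h₀ : IsInner α₀) (h₁ : IsInner α₁) (v : thompsonV) (x : Cantor) :
    IsInner (tau α₀ α₁ v x) := by
  have hword := isInner_wordAut h₀ h₁
  simp only [isInner_iff_mem_range] at *
  exact mul_mem (inv_mem (hword _)) (hword _)

lemma app_singleton_const (b : Bool) : app [b] (fun _ => b) = fun _ => b :=
  funext fun n => by cases n <;> rfl

lemma exists_smul_eq_and_tau_eq_inv (α₀ α₁ : MulAut Γ) (b : Bool) :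
    ∃ (v : thompsonV) (x : Cantor), v • x = x ∧ tau α₀ α₁ v x = (bif b then α₁ else α₀)⁻¹ := by
  obtain ⟨v, -, hv⟩ := exists_dilation [] b
  have hx := app_singleton_const b
  refine ⟨v, fun _ => b, ?_, ?_⟩
  · have h := hv fun _ => b
    rwa [List.nil_append, app_append, hx, hx] at h
  · rw [tau_eq α₀ α₁ v ⟨_, hx⟩ hv, wordAut_append_singleton, mul_inv_rev,
      mul_assoc, List.nil_append]
    exact mul_eq_left.2 (inv_mul_cancel _)

theorem isInner_of_fractionGroup_mulEquiv
    (θ : FractionGroup α₀ α₁ ≃* FractionGroup β₀ β₁) (h₀ : IsInner β₀) (h₁ : IsInner β₁) :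
    IsInner α₀ ∧ IsInner α₁ := by
  obtain ⟨T, hT⟩ := exists_loopIso θ
  have htwist : ∀ v x, IsInner (T.twist v x) := by
    intro v x
    obtain ⟨d, w, y, h⟩ := hT v x
    have hy := isInner_tau h₀ h₁ w y
    rw [isInner_iff_mem_range] at hy ⊢
    exact h ▸ mul_mem ⟨d, rfl⟩ hy
  have hinner : ∀ b : Bool, IsInner (bif b then α₁ else α₀) := by
    intro b
    obtain ⟨v, x, hvx, hτ⟩ := exists_smul_eq_and_tau_eq_inv α₀ α₁ b
    have h : IsInner (tau α₀ α₁ v x) :=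
      (htwist v x).of_intertwining (T.localIso x) fun g => by rw [← T.localIso_smul, hvx]
    rwa [hτ, isInner_iff_mem_range, inv_mem_iff, ← isInner_iff_mem_range] at h
  exact ⟨hinner false, hinner true⟩

end Inner

/-! ### Cocycles defined by words -/

section WordCocycle

variable {Λ Λ' : Type*} [Group Λ] [Group Λ']

/-- The product `h_{l_n} ⋯ h_{l_1}` for a word `l_1 ⋯ l_n`. -/
def wordProd (h : Bool → Λ) : List Bool → Λ
  | [] => 1
  | b :: m => wordProd h m * h b

lemma wordProd_append (h : Bool → Λ) (m w : List Bool) :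
    wordProd h (m ++ w) = wordProd h w * wordProd h m := by
  induction m with
  | nil => exact (mul_one _).symm
  | cons b m ih => rw [List.cons_append, wordProd, wordProd, ih, mul_assoc]

lemma map_wordProd (f : Λ →* Λ') (h : Bool → Λ) (m : List Bool) :
    f (wordProd h m) = wordProd (f ∘ h) m := by
  induction m with
  | nil => exact map_one f
  | cons b m ih => rw [wordProd, wordProd, map_mul, ih, Function.comp_apply]

/-- The element `h_w⁻¹ h_m`, where `v` exchanges the prefix `m` of `x` for `w`; by
`wordCocycle_eq` this does not depend on the choice of `m` and `w`. -/
noncomputable def wordCocycle (h : Bool → Λ) (v : thompsonV) (x : Cantor) : Λ :=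
  (wordProd h (exists_adapted v x).choose.2)⁻¹ * wordProd h (exists_adapted v x).choose.1

lemma wordCocycle_eq (h : Bool → Λ) {v : thompsonV} {x : Cantor} {m w : List Bool}
    (hx : x ∈ sdi m) (hv : Adapted v.1 m w) :
    wordCocycle h v x = (wordProd h w)⁻¹ * wordProd h m := by
  have hindep : ∀ {m w m' w' : List Bool}, x ∈ sdi m → Adapted v.1 m w → x ∈ sdi m' →
      Adapted v.1 m' w' → m.length ≤ m'.length →
      (wordProd h w')⁻¹ * wordProd h m' = (wordProd h w)⁻¹ * wordProd h m := by
    rintro m w m' w' ⟨z, rfl⟩ hv ⟨z', hz'⟩ hv' hl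
    obtain ⟨r, rfl, -⟩ := prefix_of_app_eq hz'.symm hl
    obtain rfl : w' = w ++ r := eq_of_app_eq fun y => (hv' y).symm.trans (hv.append r y)
    rw [wordProd_append, wordProd_append]
    group
  have hc := (exists_adapted v x).choose_spec
  rcases le_total m.length (exists_adapted v x).choose.1.length with hl | hl
  · exact hindep hx hv hc.1 hc.2 hl
  · exact (hindep hc.1 hc.2 hx hv hl).symm

lemma map_wordCocycle (f : Λ →* Λ') (h : Bool → Λ) (v : thompsonV) (x : Cantor) :
    f (wordCocycle h v x) = wordCocycle (f ∘ h) v x := by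
  rw [wordCocycle, wordCocycle, map_mul, map_inv, map_wordProd, map_wordProd]

lemma exists_adapted_mul (w v : thompsonV) (x : Cantor) :
    ∃ m u t, x ∈ sdi m ∧ Adapted v.1 m u ∧ Adapted w.1 u t := by
  obtain ⟨⟨m, u⟩, ⟨z, rfl⟩, hv⟩ := exists_adapted v x
  obtain ⟨N, hN⟩ := IsThompson.level w.2
  obtain ⟨r, rfl, y, rfl⟩ := exists_word N z
  obtain ⟨t, ht⟩ := hN (u ++ r) (by rw [List.length_append]; exact le_add_self)
  exact ⟨m ++ r, u ++ r, t, ⟨y, app_append m r y⟩, hv.append r, ht⟩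

lemma wordCocycle_mul (h : Bool → Λ) (w v : thompsonV) (x : Cantor) :
    wordCocycle h (w * v) x = wordCocycle h w (v • x) * wordCocycle h v x := by
  obtain ⟨m, u, t, hx, hv, hw⟩ := exists_adapted_mul w v x
  rw [wordCocycle_eq h hx (hw.mul hv), wordCocycle_eq h (hv.smul_mem_sdi_iff.2 hx) hw,
    wordCocycle_eq h hx hv]
  group

lemma isLocallyConstant_wordCocycle (h : Bool → Λ) (v : thompsonV) :
    IsLocallyConstant (wordCocycle h v) := by
  rw [IsLocallyConstant.iff_exists_open]
  intro x
  obtain ⟨⟨m, w⟩, hx, hv⟩ := exists_adapted v x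
  exact ⟨sdi m, isOpen_sdi m, hx, fun y hy => by
    rw [wordCocycle_eq h hy hv, wordCocycle_eq h hx hv]⟩

variable {Γ : Type*} [Group Γ]

lemma wordAut_eq_wordProd (α₀ α₁ : MulAut Γ) (m : List Bool) :
    wordAut α₀ α₁ m = wordProd (fun b => bif b then α₁ else α₀) m := by
  induction m with
  | nil => rfl
  | cons b m ih => rw [wordAut, wordProd, ih]

lemma tau_eq_wordCocycle (α₀ α₁ : MulAut Γ) (v : thompsonV) (x : Cantor) :
    tau α₀ α₁ v x = wordCocycle (fun b => bif b then α₁ else α₀) v x := by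
  rw [tau, wordCocycle, wordAut_eq_wordProd, wordAut_eq_wordProd]

end WordCocycle

/-! ### Untwisting -/

section Untwist

variable {Γ Δ : Type*} [Group Γ] [Group Δ]

/-- The holomorph `Γ ⋊ Aut Γ`. -/
abbrev Holomorph (Γ : Type*) [Group Γ] : Type _ := Γ ⋊[MonoidHom.id (MulAut Γ)] MulAut Γ

/-- The action of the holomorph on `Γ` by automorphisms, in which `Γ` acts by conjugation. -/
def holomorphAut : Holomorph Γ →* MulAut Γ :=
  SemidirectProduct.lift MulAut.conj (MonoidHom.id _) fun α => by
    ext g k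
    simp

variable (g₀ g₁ : Γ) (α₀ α₁ : MulAut Γ)

/-- The cocycle with values in the holomorph whose components are `τ` and the element of `Γ` by
which `τ` changes when `α₀, α₁` are multiplied by the conjugations by `g₀, g₁`. -/
noncomputable def twistCocycle : thompsonV → Cantor → Holomorph Γ :=
  wordCocycle fun b => bif b then ⟨g₁, α₁⟩ else ⟨g₀, α₀⟩

lemma right_twistCocycle (v : thompsonV) (x : Cantor) :
    (twistCocycle g₀ g₁ α₀ α₁ v x).right = tau α₀ α₁ v x := by
  rw [tau_eq_wordCocycle]
  refine (map_wordCocycle rightHom _ v x).trans ?_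
  congr 1
  funext b
  cases b <;> rfl

lemma tau_conj_mul (v : thompsonV) (x : Cantor) :
    tau (MulAut.conj g₀ * α₀) (MulAut.conj g₁ * α₁) v x =
      MulAut.conj (twistCocycle g₀ g₁ α₀ α₁ v x).left * tau α₀ α₁ v x := by
  rw [tau_eq_wordCocycle, ← right_twistCocycle g₀ g₁]
  refine Eq.trans ?_ (map_wordCocycle holomorphAut _ v x).symm
  congr 1
  funext b
  cases b <;> rfl

lemma left_twistCocycle_mul (v w : thompsonV) (x : Cantor) :
    (twistCocycle g₀ g₁ α₀ α₁ (v * w) x).left =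
      (twistCocycle g₀ g₁ α₀ α₁ v (w • x)).left *
        tau α₀ α₁ v (w • x) (twistCocycle g₀ g₁ α₀ α₁ w x).left := by
  rw [twistCocycle, wordCocycle_mul, mul_left, ← right_twistCocycle g₀ g₁]
  rfl

/-- The loop taking the value `(twistCocycle v x).left` at `v x`. -/
noncomputable def twistLoop (v : thompsonV) : LoopGroup Γ where
  toFun y := (twistCocycle g₀ g₁ α₀ α₁ v (v⁻¹ • y)).left
  isLocallyConstant := ((isLocallyConstant_wordCocycle _ v).comp_continuous
    (continuous_const_smul v⁻¹)).comp SemidirectProduct.left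

lemma twistLoop_smul (v : thompsonV) (x : Cantor) :
    twistLoop g₀ g₁ α₀ α₁ v (v • x) = (twistCocycle g₀ g₁ α₀ α₁ v x).left :=
  congrArg (fun y => (twistCocycle g₀ g₁ α₀ α₁ v y).left) (inv_smul_smul v x)

lemma jonesAction_conj_mul (v : thompsonV) (a : LoopGroup Γ) :
    jonesAction (MulAut.conj g₀ * α₀) (MulAut.conj g₁ * α₁) v a * twistLoop g₀ g₁ α₀ α₁ v =
      twistLoop g₀ g₁ α₀ α₁ v * jonesAction α₀ α₁ v a := by
  refine ext_smul v fun x => ?_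
  rw [LocallyConstant.mul_apply, LocallyConstant.mul_apply, jonesAction_apply,
    jonesAction_apply, tau_conj_mul, twistLoop_smul, MulAut.mul_apply, MulAut.conj_apply,
    inv_mul_cancel_right]

lemma twistLoop_mul (v w : thompsonV) :
    twistLoop g₀ g₁ α₀ α₁ (v * w) =
      twistLoop g₀ g₁ α₀ α₁ v * jonesAction α₀ α₁ v (twistLoop g₀ g₁ α₀ α₁ w) := by
  refine ext_smul (v * w) fun x => ?_
  rw [twistLoop_smul, left_twistCocycle_mul, mul_smul, LocallyConstant.mul_apply,
    jonesAction_apply, twistLoop_smul, twistLoop_smul]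

/-- Multiplying `α₀` and `α₁` by inner automorphisms does not change the fraction group. -/
noncomputable def untwist :
    FractionGroup (MulAut.conj g₀ * α₀) (MulAut.conj g₁ * α₁) ≃* FractionGroup α₀ α₁ where
  toFun x := ⟨x.left * twistLoop g₀ g₁ α₀ α₁ x.right, x.right⟩
  invFun x := ⟨x.left * (twistLoop g₀ g₁ α₀ α₁ x.right)⁻¹, x.right⟩
  left_inv x := SemidirectProduct.ext (mul_inv_cancel_right _ _) rfl
  right_inv x := SemidirectProduct.ext (inv_mul_cancel_right _ _) rfl
  map_mul' x y := by
    refine SemidirectProduct.ext ?_ rfl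
    simp only [mul_left, mul_right, twistLoop_mul, map_mul]
    rw [mul_assoc, ← mul_assoc (jonesAction _ _ x.right y.left), jonesAction_conj_mul]
    simp only [mul_assoc]

variable {α₀ α₁}

lemma nonempty_fractionGroup_mulEquiv_one (h₀ : IsInner α₀) (h₁ : IsInner α₁) :
    Nonempty (FractionGroup α₀ α₁ ≃* FractionGroup (1 : MulAut Γ) 1) := by
  obtain ⟨g₀, h₀⟩ := h₀
  obtain ⟨g₁, h₁⟩ := h₁
  obtain rfl := h₀.trans (mul_one _).symm
  obtain rfl := h₁.trans (mul_one _).symm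
  exact ⟨untwist g₀ g₁ 1 1⟩

lemma map_wordAut {β₀ β₁ : MulAut Δ} (f : Γ ≃* Δ) (h₀ : ∀ g, f (α₀ g) = β₀ (f g))
    (h₁ : ∀ g, f (α₁ g) = β₁ (f g)) (m : List Bool) (g : Γ) :
    f (wordAut α₀ α₁ m g) = wordAut β₀ β₁ m (f g) := by
  induction m generalizing g with
  | nil => rfl
  | cons b m ih =>
    rw [wordAut, wordAut, MulAut.mul_apply, MulAut.mul_apply, ih]
    cases b
    exacts [congrArg _ (h₀ g), congrArg _ (h₁ g)]

lemma map_tau {β₀ β₁ : MulAut Δ} (f : Γ ≃* Δ) (h₀ : ∀ g, f (α₀ g) = β₀ (f g))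
    (h₁ : ∀ g, f (α₁ g) = β₁ (f g)) (v : thompsonV) (x : Cantor) (g : Γ) :
    f (tau α₀ α₁ v x g) = tau β₀ β₁ v x (f g) := by
  refine (wordAut β₀ β₁ (exists_adapted v x).choose.2).injective ?_
  rw [← map_wordAut f h₀ h₁, tau, tau, MulAut.mul_apply, MulAut.mul_apply,
    MulAut.apply_inv_self, MulAut.apply_inv_self, map_wordAut f h₀ h₁]

/-- An isomorphism of coefficient groups that intertwines the automorphisms induces an
isomorphism of fraction groups. -/
noncomputable def fractionGroupCongr {β₀ β₁ : MulAut Δ} (f : Γ ≃* Δ)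
    (h₀ : ∀ g, f (α₀ g) = β₀ (f g)) (h₁ : ∀ g, f (α₁ g) = β₁ (f g)) :
    FractionGroup α₀ α₁ ≃* FractionGroup β₀ β₁ :=
  SemidirectProduct.congr
    { LocallyConstant.congrRight f.toEquiv with
      map_mul' := fun _ _ => LocallyConstant.ext fun _ => map_mul f _ _ }
    (MulEquiv.refl thompsonV) fun v => MulEquiv.ext fun a => ext_smul v fun x =>
      (congrArg f (jonesAction_apply α₀ α₁ v a x)).trans
        ((map_tau f h₀ h₁ v x (a x)).trans (jonesAction_apply β₀ β₁ v (a.map f) x).symm)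

end Untwist

theorem nonempty_mulEquiv_of_fractionGroup_mulEquiv {Γ Δ : Type*} [Group Γ] [Group Δ]
    {α₀ α₁ : MulAut Γ} {β₀ β₁ : MulAut Δ} (θ : FractionGroup α₀ α₁ ≃* FractionGroup β₀ β₁) :
    Nonempty (Γ ≃* Δ) := by
  obtain ⟨T, -⟩ := exists_loopIso θ
  exact ⟨T.localIso fun _ => true⟩

theorem nonempty_fractionGroup_mulEquiv_iff {Γ Δ : Type*} [Group Γ] [Group Δ]
    {α₀ α₁ : MulAut Γ} {β₀ β₁ : MulAut Δ} (h₀ : IsInner β₀) (h₁ : IsInner β₁) :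
    Nonempty (FractionGroup α₀ α₁ ≃* FractionGroup β₀ β₁) ↔
      Nonempty (Γ ≃* Δ) ∧ IsInner α₀ ∧ IsInner α₁ := by
  constructor
  · rintro ⟨θ⟩
    exact ⟨nonempty_mulEquiv_of_fractionGroup_mulEquiv θ,
      isInner_of_fractionGroup_mulEquiv θ h₀ h₁⟩
  · rintro ⟨⟨f⟩, h₀', h₁'⟩
    obtain ⟨θ⟩ := nonempty_fractionGroup_mulEquiv_one h₀' h₁'
    obtain ⟨θ'⟩ := nonempty_fractionGroup_mulEquiv_one h₀ h₁
    exact ⟨(θ.trans (fractionGroupCongr f (fun _ => rfl) fun _ => rfl)).trans θ'.symm⟩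

end DiscreteLoop

theorem theoremA {Γ : Type*} {Γ' : Type*} [Group Γ] [Group Γ']
    (α₀ α₁ : MulAut Γ) (β₀ β₁ : MulAut Γ') :
    (Nonempty (DiscreteLoop.FractionGroup α₀ α₁ ≃* DiscreteLoop.FractionGroup β₀ β₁) →
      Nonempty (Γ ≃* Γ')) ∧
    (DiscreteLoop.IsInner β₀ → DiscreteLoop.IsInner β₁ →
      (Nonempty (DiscreteLoop.FractionGroup α₀ α₁ ≃* DiscreteLoop.FractionGroup β₀ β₁) ↔
        Nonempty (Γ ≃* Γ') ∧ DiscreteLoop.IsInner α₀ ∧ DiscreteLoop.IsInner α₁)) ∧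
    (Nonempty (DiscreteLoop.FractionGroup (1 : MulAut Γ) 1 ≃*
        DiscreteLoop.FractionGroup (1 : MulAut Γ') 1) ↔
      Nonempty (Γ ≃* Γ')) := by
  refine ⟨fun ⟨θ⟩ => DiscreteLoop.nonempty_mulEquiv_of_fractionGroup_mulEquiv θ,
    fun h₀ h₁ => DiscreteLoop.nonempty_fractionGroup_mulEquiv_iff h₀ h₁, ?_⟩
  rw [DiscreteLoop.nonempty_fractionGroup_mulEquiv_iff DiscreteLoop.isInner_one
    DiscreteLoop.isInner_one]
  exact and_iff_left ⟨DiscreteLoop.isInner_one, DiscreteLoop.isInner_one⟩
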